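/- Let $\mathcal G$ be an undirected weighted graph on $n$ vertices with symmetric, entrywise non-negative weighted adjacency matrix $W_{\mathcal G}\in\mathbb R^{n\times n}$, degree matrix $D=\mathrm{diag}(W_{\mathcal G}\mathbf 1)$ and normalized Laplacian $L=I-D^{-1/2}W_{\mathcal G}D^{-1/2}$ (with $0^{-1/2}:=0$ at vertices of degree zero). Let $L=U\Sigma U^\top$ be any eigendecomposition with $U=(u_1,\dots,u_n)$ orthogonal and $\Sigma=\mathrm{diag}(\sigma_1,\dots,\sigma_n)$, $\sigma_1\le\cdots\le\sigma_n$. Fix $\Delta t>0$ and set $A=e^{-\Delta t L}$, $\lambda_i=e^{-\Delta t\,\sigma_i}$. Let $T\ge 1$ and $1\le k\le n$ be integers. A signal $x\in\mathbb R^n$ is $k$-bandlimited if $x\in\mathrm{span}(u_1,\dots,u_k)$. Put $$f_T(\lambda)=\Big(\sum_{t=0}^{T-1}\lambda^{2t}\Big)^{1/2},\qquad \pi_{A,T}(x)=\big(x,Ax,\dots,A^{T-1}x\big)\in\mathbb R^{Tn},$$ index the coordinates of $\mathbb R^{Tn}$ by pairs $(t,i)$ with $0\le t\le T-1$, $1\le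 i\le n$, and let $\widetilde U\in\mathbb R^{Tn\times k}$ be the matrix with entries $\widetilde U_{(t,i),\ell}=\frac{\lambda_\ell^t}{f_T(\lambda_\ell)}\,u_\ell(i)$. All probability distributions below are entrywise nonzero, and samples are drawn independently with replacement. 1. (Random vertices, kept for all times.) $p$ is a probability distribution on $\{1,\dots,n\}$; $\omega_1,\dots,\omega_m$ are drawn from $p$. $S\in\mathbb R^{Tm\times Tn}$ is block diagonal with $T$ equal blocks $S^{(0)}\in\mathbb R^{m\times n}$, $S^{(0)}_{ij}=1$ if $j=\omega_i$ and $0$ otherwise; $P$ is block diagonal with $T$ blocks $\mathrm{diag}(p)$; $W=\frac1m I_{Tm}$; the coherence is $\nu=\max_{1\le i\le n}p(i)^{-1/2}\big\|\widetilde U_{\{(t,i):0\le t<T\},\,\cdot}\big\|_2$, with the spectral norm of the $T\times k$ row submatrix. 2. (Random vertices at each time.) For each $t\in\{0,\dots,T-1\}$, $p_t$ is a probability distribution on $\{1,\dots,n\}$ and $\omega_{t,1},\dots,\omega_{t,m_t}$ are drawn from $p_t$ (all samples, over all $t$, being independent). $S$ is block diagonal with blocks $S^{(t)}\in\mathbb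 R^{m_t\times n}$, $S^{(t)}_{ij}=1$ if $j=\omega_{t,i}$ and $0$ otherwise; $P$ is block diagonal with blocks $\mathrm{diag}(p_t)$; $W$ is block diagonal with blocks $\frac1{m_t}I_{m_t}$; the coherence at time $t$ is $\nu(t)=\max_{1\le i\le n}p_t(i)^{-1/2}\|\widetilde U^\top\delta_{(t,i)}\|_2$. 3. (Random space-time nodes.) $p$ is a probability distribution on the $Tn$ space-time nodes $(t,i)$; $\omega_1,\dots,\omega_m$ are drawn from $p$. $S\in\mathbb R^{m\times Tn}$, $S_{js}=1$ if $s=\omega_j$ and $0$ otherwise; $P=\mathrm{diag}(p)$; $W=\frac1m I_m$; the coherence is $\nu=\max_{s}p(s)^{-1/2}\|\widetilde U^\top\delta_s\|_2$. In each regime let $P_\Omega$ be the diagonal part of $SPS^\top$. Then for all $\delta,\epsilon\in(0,1)$: if $$m\ge\frac3{\delta^2}\,\nu^2\log\frac{2k}{\epsilon}\quad\text{(regimes 1 and 3)},\qquad m_t\ge\frac3{\delta^2}\,\nu(t)^2\log\frac{2k}{\epsilon}\ \text{ for all } t=0,\dots,T-1\quad\text{(regime 2)},$$ then with probability at least $1-\epsilon$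 it holds simultaneously for all $k$-bandlimited $x$ that $$(1-\delta)\,f_T(\lambda_k)^2\,\|x\|_2^2\ \le\ \big\|P_\Omega^{-1/2}W^{1/2}S\,\pi_{A,T}(x)\big\|_2^2\ \le\ (1+\delta)\,f_T(\lambda_1)^2\,\|x\|_2^2 .$$ -/

import Mathlib

noncomputable section

namespace DynSampling

open MeasureTheory ProbabilityTheory Matrix

/-- An undirected weighted graph on the vertices `0, …, n-1`, given by its weighted adjacency
matrix; `{i, j}` is an edge when `weight i j` is positive. -/
structure WeightedGraph (n : ℕ) where
  weight : Matrix (Fin n) (Fin n) ℝ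
  symm : weight.IsSymm
  nonneg : ∀ i j, 0 ≤ weight i j

namespace WeightedGraph

variable {n : ℕ} (G : WeightedGraph n)

def degree (i : Fin n) : ℝ := ∑ j, G.weight i j

/-- `D^{-1/2}`, with entry `0` at a vertex of degree zero. -/
def invSqrtDegree : Matrix (Fin n) (Fin n) ℝ := diagonal fun i => (√(G.degree i))⁻¹

/-- The diffusion matrix `N = D^{-1/2} W D^{-1/2}`. -/
def diffusion : Matrix (Fin n) (Fin n) ℝ := G.invSqrtDegree * G.weight * G.invSqrtDegree

/-- The normalized graph Laplacian `L = I - N`. -/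
def laplacian : Matrix (Fin n) (Fin n) ℝ := 1 - G.diffusion

/-- `A = exp(-Δt L)`. -/
def heat (Δt : ℝ) : Matrix (Fin n) (Fin n) ℝ := NormedSpace.exp (-(Δt • G.laplacian))

/-- An eigendecomposition `L = U Σ Uᵀ` with `U` orthogonal and eigenvalues in increasing order. -/
structure EigenDecomposition where
  U : Matrix (Fin n) (Fin n) ℝ
  σ : Fin n → ℝ
  orthogonal : U ∈ Matrix.orthogonalGroup (Fin n) ℝ
  monotone : Monotone σ
  decomp : G.laplacian = U * diagonal σ * Uᵀ

end WeightedGraph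

/-- The space-time nodes `(t, i)`, `t = 0, …, T-1`, `i = 0, …, n-1`, that index `ℝ^{Tn}`
(`T` blocks of length `n`). -/
abbrev SpaceTime (T n : ℕ) : Type := Σ _ : Fin T, Fin n

/-- `f_T(λ) = √(∑_{t=0}^{T-1} λ^{2t})`. -/
def fT (T : ℕ) (l : ℝ) : ℝ := √(∑ t ∈ Finset.range T, l ^ (2 * t))

/-- `π_{A,T}(x) = (x, A x, …, A^{T-1} x)`. -/
def trajectory {n : ℕ} (A : Matrix (Fin n) (Fin n) ℝ) (T : ℕ) (x : EuclideanSpace ℝ (Fin n)) :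
    EuclideanSpace ℝ (SpaceTime T n) :=
  WithLp.toLp 2 fun s => ((A ^ (s.1 : ℕ)) *ᵥ x.ofLp) s.2

section Spectral

variable {n : ℕ} {G : WeightedGraph n} (E : G.EigenDecomposition)

/-- The eigenvalues `λ_i = exp(-Δt σ_i)` of `A`, in decreasing order. -/
def eigA (Δt : ℝ) (i : Fin n) : ℝ := Real.exp (-(Δt * E.σ i))

/-- The set of `k`-bandlimited signals: the span of the first `k` columns of `U`. -/
def bandlimited {k : ℕ} (hk : k ≤ n) : Submodule ℝ (EuclideanSpace ℝ (Fin n)) :=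
  Submodule.span ℝ (Set.range fun l : Fin k => WithLp.toLp 2 fun i => E.U i (Fin.castLE hk l))

/-- The `Tn × k` matrix `Ũ_{k,T}`, whose `t`-th block has columns `(λ_l^t / f_T(λ_l)) u_l`. -/
def Utilde (Δt : ℝ) (T : ℕ) {k : ℕ} (hk : k ≤ n) : Matrix (SpaceTime T n) (Fin k) ℝ :=
  Matrix.of fun s l =>
    eigA E Δt (Fin.castLE hk l) ^ (s.1 : ℕ) / fT T (eigA E Δt (Fin.castLE hk l))
      * E.U s.2 (Fin.castLE hk l)

/-- `‖Ũ_{k,T}ᵀ δ_s‖₂` at the space-time node `s`. -/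
def nodeNorm (Δt : ℝ) (T : ℕ) {k : ℕ} (hk : k ≤ n) (s : SpaceTime T n) : ℝ :=
  ‖WithLp.toLp 2 ((Utilde E Δt T hk)ᵀ *ᵥ Pi.single s 1)‖

open scoped Matrix.Norms.L2Operator in
/-- The spectral norm of the `T × k` submatrix of `Ũ_{k,T}` whose rows are the space-time nodes
over the vertex `i`. -/
def vertexNorm (Δt : ℝ) (T : ℕ) {k : ℕ} (hk : k ≤ n) (i : Fin n) : ℝ :=
  ‖(Utilde E Δt T hk).submatrix (fun t : Fin T => (⟨t, i⟩ : SpaceTime T n)) id‖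

/-- Spectral graph weighted coherence of order `(k, T)`, regime 1. -/
def coherence₁ (Δt : ℝ) (T : ℕ) {k : ℕ} (hk : k ≤ n) (p : Fin n → ℝ) : ℝ :=
  ⨆ i : Fin n, 1 / √(p i) * vertexNorm E Δt T hk i

/-- Spectral graph weighted coherence of order `(k, T)`, regime 2 (a vector indexed by time). -/
def coherence₂ (Δt : ℝ) (T : ℕ) {k : ℕ} (hk : k ≤ n) (p : Fin T → Fin n → ℝ) (t : Fin T) : ℝ :=
  ⨆ i : Fin n, 1 / √(p t i) * nodeNorm E Δt T hk ⟨t, i⟩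

/-- Spectral graph weighted coherence of order `(k, T)`, regime 3. -/
def coherence₃ (Δt : ℝ) (T : ℕ) {k : ℕ} (hk : k ≤ n) (p : SpaceTime T n → ℝ) : ℝ :=
  ⨆ s : SpaceTime T n, 1 / √(p s) * nodeNorm E Δt T hk s

end Spectral

section Sampling

/-- An entrywise nonzero probability distribution on a finite set. -/
def IsNondegenerateDistribution {α : Type*} [Fintype α] (p : α → ℝ) : Prop :=
  (∀ a, 0 < p a) ∧ ∑ a, p a = 1

/-- The random variables `ω_j` are drawn independently, each with distribution `p_j`. -/
def IsIndependentSample {Ω ι α : Type*} [MeasurableSpace Ω] [MeasurableSpace α]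
    (μ : Measure Ω) (p : ι → α → ℝ) (ω : ι → Ω → α) : Prop :=
  (∀ j, Measurable (ω j)) ∧ iIndepFun ω μ ∧ ∀ j a, μ.real (ω j ⁻¹' {a}) = p j a

/-- The matrix with `(i, j)` entry `1` if `j = ω_i` and `0` otherwise. -/
def selection {ι α : Type*} [DecidableEq α] (ω : ι → α) : Matrix ι α ℝ :=
  Matrix.of fun i j => if j = ω i then 1 else 0

/-- The real power `M^r` of a diagonal matrix `M` with positive diagonal entries. -/
def diagPow {ι : Type*} [DecidableEq ι] (M : Matrix ι ι ℝ) (r : ℝ) : Matrix ι ι ℝ :=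
  diagonal fun i => M i i ^ r

/-- `P_Ω = diag(S P Sᵀ)`, the diagonal part of `S P Sᵀ`. -/
def sampledProb {ρ κ : Type*} [DecidableEq ρ] [Fintype κ]
    (P : Matrix κ κ ℝ) (S : Matrix ρ κ ℝ) : Matrix ρ ρ ℝ :=
  diagonal fun i => (S * P * Sᵀ) i i

/-- `P_Ω^{-1/2} W^{1/2} S`. -/
def samplingOp {ρ κ : Type*} [Fintype ρ] [DecidableEq ρ] [Fintype κ]
    (P : Matrix κ κ ℝ) (W : Matrix ρ ρ ℝ) (S : Matrix ρ κ ℝ) : Matrix ρ κ ℝ :=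
  diagPow (sampledProb P S) (-(1 / 2)) * diagPow W (1 / 2) * S

variable {n T : ℕ}

/-- Regime 1: the same sampled vertices `ω_1, …, ω_m` at all times. -/
def samplingOp₁ {m : ℕ} (p : Fin n → ℝ) (ω : Fin m → Fin n) :
    Matrix (Σ _ : Fin T, Fin m) (SpaceTime T n) ℝ :=
  samplingOp (blockDiagonal' fun _ : Fin T => diagonal p)
    ((1 / (m : ℝ)) • (1 : Matrix (Σ _ : Fin T, Fin m) (Σ _ : Fin T, Fin m) ℝ))
    (blockDiagonal' fun _ : Fin T => selection ω)

/-- Regime 2: sampled vertices `ω_{t,1}, …, ω_{t,m_t}` at time `t`. -/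
def samplingOp₂ {m : Fin T → ℕ} (p : Fin T → Fin n → ℝ) (ω : (Σ t : Fin T, Fin (m t)) → Fin n) :
    Matrix (Σ t : Fin T, Fin (m t)) (SpaceTime T n) ℝ :=
  samplingOp (blockDiagonal' fun t : Fin T => diagonal (p t))
    (blockDiagonal' fun t : Fin T => (1 / (m t : ℝ)) • (1 : Matrix (Fin (m t)) (Fin (m t)) ℝ))
    (blockDiagonal' fun t : Fin T => selection fun j : Fin (m t) => ω ⟨t, j⟩)

/-- Regime 3: sampled space-time nodes `ω_1, …, ω_m`. -/
def samplingOp₃ {m : ℕ} (p : SpaceTime T n → ℝ) (ω : Fin m → SpaceTime T n) :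
    Matrix (Fin m) (SpaceTime T n) ℝ :=
  samplingOp (diagonal p) ((1 / (m : ℝ)) • (1 : Matrix (Fin m) (Fin m) ℝ)) (selection ω)

end Sampling

/-- The two-sided bound `(1-δ) f_T(λ_k)² ‖x‖² ≤ ‖B π_{A,T}(x)‖² ≤ (1+δ) f_T(λ_1)² ‖x‖²` for all
`k`-bandlimited `x`; in the zero-based numbering of `Fin n`, `λ_k` has index `k - 1`. -/
def StablyEmbeds {n T k : ℕ} {G : WeightedGraph n} (E : G.EigenDecomposition) (Δt : ℝ)
    (hk0 : 0 < k) (hk : k ≤ n) (δ : ℝ) {ρ : Type*} [Fintype ρ]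
    (B : Matrix ρ (SpaceTime T n) ℝ) : Prop :=
  ∀ x ∈ bandlimited E hk,
    (1 - δ) * fT T (eigA E Δt ⟨k - 1, by omega⟩) ^ 2 * ‖x‖ ^ 2
        ≤ ‖WithLp.toLp 2 (B *ᵥ (trajectory (G.heat Δt) T x).ofLp)‖ ^ 2 ∧
    ‖WithLp.toLp 2 (B *ᵥ (trajectory (G.heat Δt) T x).ofLp)‖ ^ 2
        ≤ (1 + δ) * fT T (eigA E Δt ⟨0, by omega⟩) ^ 2 * ‖x‖ ^ 2

end DynSampling

end

/-!
With `U_k = (u_1, …, u_k)`, a `k`-bandlimited signal `x = U_k c` has trajectory `Ũ w` with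
`w_ℓ = f_T(λ_ℓ) c_ℓ`, and `ŨᵀŨ = 1`. As `f_T(λ_k) ‖x‖ ≤ ‖w‖ ≤ f_T(λ_1) ‖x‖`, it suffices that the
Gram matrix of `P_Ω^{-1/2} W^{1/2} S Ũ` lies within `δ` of the identity in the Loewner order.

In each regime this Gram matrix is a sum of independent positive semidefinite matrices, one per
sample, with expectation `ŨᵀŨ = 1`; by the choice of `p`-weights each summand is at most
`R = ν² / m` times the identity, where `ν` is the coherence. The matrix Chernoff inequality bounds
the failure probability by `2 k exp (-δ² / (3 R))`, which is at most `ε` for `m` as assumed.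
The three regimes are instances of one stratified scheme, in which the samples are split into
strata with their own distributions.

The Chernoff inequality is proved following Tropp: the joint convexity of the quantum relative
entropy `tr A (log A - log B)` gives, through the Gibbs variational principle, the subadditivity of
matrix cumulant generating functions. Joint convexity itself comes from an integral representation
of the relative entropy whose integrand is a supremum of functionals linear in `(A, B)`.
-/

noncomputable section

namespace DynSampling

open Filter MeasureTheory ProbabilityTheory Matrix RCLike
open scoped ComplexOrder MatrixOrder Topology

theorem posDef_sum_smul {𝕜 ι α : Type*} [RCLike 𝕜] [Fintype α] {p : α → ℝ} (hp : ∀ a, 0 ≤ p a)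
    (hp1 : ∑ a, p a = 1) {P : α → Matrix ι ι 𝕜} (hP : ∀ a, (P a).PosDef) :
    (∑ a, p a • P a).PosDef := by
  classical
  obtain ⟨b, -, hb⟩ := Finset.exists_ne_zero_of_sum_ne_zero (hp1.trans_ne one_ne_zero)
  rw [← Finset.add_sum_erase _ _ (Finset.mem_univ b)]
  refine ((hP b).smul ((hp b).lt_of_ne' hb)).add_posSemidef ?_
  exact posSemidef_sum _ fun a _ => (hP a).posSemidef.smul (hp a)

section RelativeEntropy

variable {𝕜 ι : Type*} [RCLike 𝕜] [Fintype ι] {A B : Matrix ι ι 𝕜}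

theorem re_trace_mono (h : A ≤ B) : re A.trace ≤ re B.trace := by
  have := (RCLike.nonneg_iff.1 (Matrix.le_iff.1 h).trace_nonneg).1
  rwa [trace_sub, map_sub, sub_nonneg] at this

/-- The quadratic functional `Z ↦ 2 tr (A Z) - tr (Zᴴ B Z) - t tr (Z A Zᴴ)`, whose maximum over `Z`
is the resolvent term of the relative entropy. It is linear in `(A, B)`. -/
def resolventFunctional (t : ℝ) (A B Z : Matrix ι ι 𝕜) : ℝ :=
  2 * re (A * Z).trace - re (Zᴴ * B * Z).trace - t * re (Z * A * Zᴴ).trace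

theorem resolventFunctional_sum_smul {α : Type*} [Fintype α] (p : α → ℝ)
    (P Q : α → Matrix ι ι 𝕜) (t : ℝ) (Z : Matrix ι ι 𝕜) :
    resolventFunctional t (∑ a, p a • P a) (∑ a, p a • Q a) Z
      = ∑ a, p a * resolventFunctional t (P a) (Q a) Z := by
  simp only [resolventFunctional, Matrix.sum_mul, trace_sum, smul_mul_assoc,
    mul_smul_comm, trace_smul, map_sum, smul_re, Finset.mul_sum, ← Finset.sum_sub_distrib]
  exact Finset.sum_congr rfl fun a _ => by ring

theorem resolventFunctional_anti {C : Matrix ι ι 𝕜} {t : ℝ} (h : B ≤ C) (Z : Matrix ι ι 𝕜) :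
    resolventFunctional t A C Z ≤ resolventFunctional t A B Z := by
  have hZ := re_trace_mono (star_left_conjugate_le_conjugate h Z)
  rw [star_eq_conjTranspose] at hZ
  unfold resolventFunctional
  linarith

variable [DecidableEq ι]

/-- The sum `∑ᵢⱼ |⟨uᵢ, vⱼ⟩|² φ(aᵢ, bⱼ)` over orthonormal eigenbases `uᵢ` of `A` and `vⱼ` of `B` with
eigenvalues `aᵢ` and `bⱼ`. It reduces trace inequalities for a pair of matrices to inequalities
between functions of two real variables. -/
def jointSpectralSum (hA : A.IsHermitian) (hB : B.IsHermitian) (φ : ℝ → ℝ → ℝ) : ℝ :=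
  ∑ i, ∑ j, ‖((hA.eigenvectorUnitary : Matrix ι ι 𝕜)ᴴ * hB.eigenvectorUnitary) i j‖ ^ 2
    * φ (hA.eigenvalues i) (hB.eigenvalues j)

theorem jointSpectralSum_mono (hA : A.PosDef) (hB : B.PosDef) {φ ψ : ℝ → ℝ → ℝ}
    (h : ∀ a > 0, ∀ b > 0, φ a b ≤ ψ a b) :
    jointSpectralSum hA.1 hB.1 φ ≤ jointSpectralSum hA.1 hB.1 ψ := by
  unfold jointSpectralSum
  gcongr with i _ j _
  exact h _ (hA.eigenvalues_pos i) _ (hB.eigenvalues_pos j)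

theorem jointSpectralSum_sub (hA : A.IsHermitian) (hB : B.IsHermitian) (φ ψ : ℝ → ℝ → ℝ) :
    jointSpectralSum hA hB (fun a b => φ a b - ψ a b)
      = jointSpectralSum hA hB φ - jointSpectralSum hA hB ψ := by
  simp only [jointSpectralSum, mul_sub, Finset.sum_sub_distrib]

theorem re_trace_diagonal_mul_mul (d : ι → ℝ) (C W : Matrix ι ι 𝕜) :
    re (diagonal (ofReal ∘ d) * C * W).trace = ∑ i, ∑ j, d i * re (C i j * W j i) := by
  simp only [trace, diag_apply, Matrix.mul_apply (N := W), diagonal_mul, map_sum]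
  refine Finset.sum_congr rfl fun i _ => Finset.sum_congr rfl fun j _ => ?_
  rw [mul_assoc, Function.comp_apply, re_ofReal_mul]

theorem re_trace_diagonal_mul_mul_diagonal_mul (d e : ι → ℝ) (C : Matrix ι ι 𝕜) :
    re (diagonal (ofReal ∘ d) * C * diagonal (ofReal ∘ e) * Cᴴ : Matrix ι ι 𝕜).trace
      = ∑ i, ∑ j, ‖C i j‖ ^ 2 * (d i * e j) := by
  simp only [trace, diag_apply, Matrix.mul_apply (N := Cᴴ), mul_diagonal, diagonal_mul,
    conjTranspose_apply, map_sum, Function.comp_apply]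
  refine Finset.sum_congr rfl fun i _ => Finset.sum_congr rfl fun j _ => ?_
  rw [mul_right_comm, mul_assoc (d i : 𝕜), RCLike.star_def, RCLike.mul_conj]
  norm_cast
  ring

theorem cfc_eq_eigenvectorUnitary_mul (hA : A.IsHermitian) (f : ℝ → ℝ) :
    cfc f A = (hA.eigenvectorUnitary : Matrix ι ι 𝕜) * diagonal (ofReal ∘ f ∘ hA.eigenvalues)
      * (hA.eigenvectorUnitary : Matrix ι ι 𝕜)ᴴ := by
  rw [hA.cfc_eq, Matrix.IsHermitian.cfc, Unitary.conjStarAlgAut_apply, star_eq_conjTranspose]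

theorem re_trace_cfc_mul_cfc (hA : A.IsHermitian) (hB : B.IsHermitian) (f g : ℝ → ℝ) :
    re (cfc f A * cfc g B).trace = jointSpectralSum hA hB fun a b => f a * g b := by
  rw [cfc_eq_eigenvectorUnitary_mul hA, cfc_eq_eigenvectorUnitary_mul hB, Matrix.mul_assoc,
    Matrix.mul_assoc, trace_mul_comm]
  refine Eq.trans ?_ <|
    re_trace_diagonal_mul_mul_diagonal_mul (f ∘ hA.eigenvalues) (g ∘ hB.eigenvalues) _
  simp only [conjTranspose_mul, conjTranspose_conjTranspose,
    Matrix.mul_assoc]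

theorem re_trace_eq_jointSpectralSum_left (hA : A.IsHermitian) (hB : B.IsHermitian) :
    re A.trace = jointSpectralSum hA hB fun a _ => a := by
  have h := re_trace_cfc_mul_cfc hA hB id 1
  simpa only [cfc_id ℝ A hA.isSelfAdjoint, cfc_one ℝ B hB.isSelfAdjoint, id, Pi.one_apply, mul_one]
    using h

theorem re_trace_eq_jointSpectralSum_right (hA : A.IsHermitian) (hB : B.IsHermitian) :
    re B.trace = jointSpectralSum hA hB fun _ b => b := by
  have h := re_trace_cfc_mul_cfc hA hB 1 id
  simpa only [cfc_id ℝ B hB.isSelfAdjoint, cfc_one ℝ A hA.isSelfAdjoint, id, Pi.one_apply, one_mul]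
    using h

/-- The quantum (Umegaki) relative entropy `D(A ‖ B) = tr A (log A - log B)`. -/
def relEntropy (A B : Matrix ι ι 𝕜) : ℝ :=
  re (A * (cfc Real.log A - cfc Real.log B)).trace

theorem relEntropy_eq_jointSpectralSum (hA : A.IsHermitian) (hB : B.IsHermitian) :
    relEntropy A B = jointSpectralSum hA hB fun a b => a * (Real.log a - Real.log b) := by
  have hAA : re (A * cfc Real.log A).trace
      = jointSpectralSum hA hB fun a _ => a * Real.log a := by
    have h := re_trace_cfc_mul_cfc hA hB (fun a => a * Real.log a) 1
    rw [cfc_mul (fun a : ℝ => a) Real.log A (A.finite_real_spectrum.continuousOn _)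
      (A.finite_real_spectrum.continuousOn _), cfc_id' ℝ A hA.isSelfAdjoint,
      cfc_one ℝ B hB.isSelfAdjoint, mul_one] at h
    simpa only [Pi.one_apply, mul_one] using h
  have hAB := re_trace_cfc_mul_cfc hA hB id Real.log
  rw [cfc_id ℝ A hA.isSelfAdjoint] at hAB
  rw [relEntropy, mul_sub, trace_sub, map_sub, hAA, hAB, ← jointSpectralSum_sub]
  simp only [id, mul_sub]

/-- Klein's inequality. -/
theorem re_trace_sub_le_relEntropy (hA : A.PosDef) (hB : B.PosDef) :
    re A.trace - re B.trace ≤ relEntropy A B := by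
  rw [re_trace_eq_jointSpectralSum_left hA.1 hB.1, re_trace_eq_jointSpectralSum_right hA.1 hB.1,
    relEntropy_eq_jointSpectralSum hA.1 hB.1, ← jointSpectralSum_sub]
  refine jointSpectralSum_mono hA hB fun a ha b hb => ?_
  have h := mul_le_mul_of_nonneg_left (Real.log_le_sub_one_of_pos (div_pos hb ha)) ha.le
  rw [Real.log_div hb.ne' ha.ne', mul_sub a (b / a), mul_div_cancel₀ _ ha.ne'] at h
  linarith

theorem resolventFunctional_conj {U V : Matrix ι ι 𝕜} (hU : Uᴴ * U = 1) (hV : Vᴴ * V = 1)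
    (t : ℝ) (D E W : Matrix ι ι 𝕜) :
    resolventFunctional t (U * D * Uᴴ) (V * E * Vᴴ) (V * W * Uᴴ)
      = 2 * re (D * (Uᴴ * V) * W).trace - re (Wᴴ * E * W).trace - t * re (W * D * Wᴴ).trace := by
  have cancel_U (M : Matrix ι ι 𝕜) : Uᴴ * (U * M) = M := by rw [← Matrix.mul_assoc, hU, one_mul]
  have cancel_V (M : Matrix ι ι 𝕜) : Vᴴ * (V * M) = M := by rw [← Matrix.mul_assoc, hV, one_mul]
  have hlin : (U * D * Uᴴ * (V * W * Uᴴ)).trace = (D * (Uᴴ * V) * W).trace := by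
    rw [trace_mul_comm (D * (Uᴴ * V)), Matrix.mul_assoc U, Matrix.mul_assoc U, trace_mul_comm U,
      trace_mul_comm W]
    simp only [Matrix.mul_assoc, hU, mul_one]
  have hB : ((V * W * Uᴴ)ᴴ * (V * E * Vᴴ) * (V * W * Uᴴ)).trace = (Wᴴ * E * W).trace := by
    simp only [conjTranspose_mul, conjTranspose_conjTranspose, Matrix.mul_assoc, cancel_V]
    rw [trace_mul_comm U]
    simp only [Matrix.mul_assoc, hU, mul_one]
  have hA : (V * W * Uᴴ * (U * D * Uᴴ) * (V * W * Uᴴ)ᴴ).trace = (W * D * Wᴴ).trace := by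
    simp only [conjTranspose_mul, conjTranspose_conjTranspose, Matrix.mul_assoc, cancel_U]
    rw [trace_mul_comm V]
    simp only [Matrix.mul_assoc, hV, mul_one]
  rw [resolventFunctional, hlin, hB, hA]

theorem resolventFunctional_eq_sum (hA : A.IsHermitian) (hB : B.IsHermitian) (t : ℝ)
    (W : Matrix ι ι 𝕜) :
    resolventFunctional t A B
        (hB.eigenvectorUnitary * W * (hA.eigenvectorUnitary : Matrix ι ι 𝕜)ᴴ)
      = ∑ i, ∑ j, (2 * (hA.eigenvalues i
            * re (((hA.eigenvectorUnitary : Matrix ι ι 𝕜)ᴴ * hB.eigenvectorUnitary) i j * W j i))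
          - (hB.eigenvalues j + t * hA.eigenvalues i) * ‖W j i‖ ^ 2) := by
  have spectral {C : Matrix ι ι 𝕜} (hC : C.IsHermitian) :
      (hC.eigenvectorUnitary : Matrix ι ι 𝕜) * diagonal (ofReal ∘ hC.eigenvalues)
        * (hC.eigenvectorUnitary : Matrix ι ι 𝕜)ᴴ = C := by
    rw [← Function.id_comp hC.eigenvalues, ← cfc_eq_eigenvectorUnitary_mul hC,
      cfc_id ℝ C hC.isSelfAdjoint]
  have hWB := re_trace_diagonal_mul_mul_diagonal_mul 1 hB.eigenvalues Wᴴ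
  have hWA := re_trace_diagonal_mul_mul_diagonal_mul 1 hA.eigenvalues W
  have hone : (diagonal (ofReal ∘ (1 : ι → ℝ)) : Matrix ι ι 𝕜) = 1 := by
    simp [← diagonal_one, Function.comp_def]
  have h := resolventFunctional_conj (Unitary.coe_star_mul_self hA.eigenvectorUnitary)
    (Unitary.coe_star_mul_self hB.eigenvectorUnitary) t (diagonal (ofReal ∘ hA.eigenvalues))
    (diagonal (ofReal ∘ hB.eigenvalues)) W
  rw [hone, one_mul, conjTranspose_conjTranspose] at hWB
  rw [hone, one_mul, Finset.sum_comm] at hWA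
  rw [spectral hA, spectral hB] at h
  rw [h, re_trace_diagonal_mul_mul, hWA, hWB]
  simp only [Finset.mul_sum, ← Finset.sum_sub_distrib, conjTranspose_apply, norm_star,
    Pi.one_apply]
  exact Finset.sum_congr rfl fun i _ => Finset.sum_congr rfl fun j _ => by ring

/-- The maximum of `resolventFunctional t A B`, written as a joint spectral sum; its integral over
`t` is the relative entropy up to a trace term. -/
def resolventForm (t : ℝ) (hA : A.IsHermitian) (hB : B.IsHermitian) : ℝ :=
  jointSpectralSum hA hB fun a b => a ^ 2 / (b + t * a)

theorem isGreatest_two_mul_re_sub {d : ℝ} (hd : 0 < d) (a : ℝ) (c : 𝕜) :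
    IsGreatest (Set.range fun w : 𝕜 => 2 * (a * re (c * w)) - d * ‖w‖ ^ 2)
      (‖c‖ ^ 2 * (a ^ 2 / d)) := by
  constructor
  · refine ⟨(a / d : ℝ) * star c, ?_⟩
    beta_reduce
    rw [mul_left_comm c, RCLike.star_def, RCLike.mul_conj, norm_mul, norm_conj, norm_ofReal,
      mul_pow, sq_abs, ← ofReal_pow, ← ofReal_mul, ofReal_re]
    field_simp
    ring
  · rintro _ ⟨w, rfl⟩
    have h : a * re (c * w) ≤ |a| * (‖c‖ * ‖w‖) :=
      calc a * re (c * w) ≤ |a| * |re (c * w)| := (le_abs_self _).trans_eq (abs_mul _ _)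
        _ ≤ |a| * (‖c‖ * ‖w‖) := by
          rw [← norm_mul]
          gcongr
          exact abs_re_le_norm _
    rw [← mul_div_assoc, le_div_iff₀ hd, ← sq_abs a]
    nlinarith [sq_nonneg (d * ‖w‖ - ‖c‖ * |a|)]

theorem isGreatest_resolventForm {t : ℝ} (ht : 0 ≤ t) (hA : A.PosDef) (hB : B.PosDef) :
    IsGreatest (Set.range (resolventFunctional t A B)) (resolventForm t hA.1 hB.1) := by
  have hentry (i j : ι) := isGreatest_two_mul_re_sub
    (add_pos_of_pos_of_nonneg (hB.eigenvalues_pos j) (mul_nonneg ht (hA.eigenvalues_pos i).le))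
    (hA.1.eigenvalues i) (((hA.1.eigenvectorUnitary : Matrix ι ι 𝕜)ᴴ * hB.1.eigenvectorUnitary) i j)
  constructor
  · choose w hw using fun i j => (hentry i j).1
    refine ⟨_, (resolventFunctional_eq_sum hA.1 hB.1 t (of fun j i => w i j)).trans ?_⟩
    exact Finset.sum_congr rfl fun i _ => Finset.sum_congr rfl fun j _ => hw i j
  · rintro _ ⟨Z, rfl⟩
    have hU : (hA.1.eigenvectorUnitary : Matrix ι ι 𝕜) * (hA.1.eigenvectorUnitary : Matrix ι ι 𝕜)ᴴ
        = 1 := Unitary.coe_mul_star_self hA.1.eigenvectorUnitary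
    have hV : (hB.1.eigenvectorUnitary : Matrix ι ι 𝕜) * (hB.1.eigenvectorUnitary : Matrix ι ι 𝕜)ᴴ
        = 1 := Unitary.coe_mul_star_self hB.1.eigenvectorUnitary
    have hZ : Z = hB.1.eigenvectorUnitary * ((hB.1.eigenvectorUnitary : Matrix ι ι 𝕜)ᴴ * Z
        * hA.1.eigenvectorUnitary) * (hA.1.eigenvectorUnitary : Matrix ι ι 𝕜)ᴴ := by
      simp only [Matrix.mul_assoc, hU, mul_one]
      rw [← Matrix.mul_assoc, hV, one_mul]
    rw [hZ, resolventFunctional_eq_sum]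
    exact Finset.sum_le_sum fun i _ => Finset.sum_le_sum fun j _ => (hentry i j).2 ⟨_, rfl⟩

section Jensen

variable {α : Type*} [Fintype α] {p : α → ℝ} {P Q : α → Matrix ι ι 𝕜}

theorem resolventForm_sum_smul_le {t : ℝ} (ht : 0 ≤ t) (hp : ∀ a, 0 ≤ p a)
    (hP : ∀ a, (P a).PosDef) (hQ : ∀ a, (Q a).PosDef) (hPsum : (∑ a, p a • P a).PosDef)
    (hB : B.PosDef) (h : ∑ a, p a • Q a ≤ B) :
    resolventForm t hPsum.1 hB.1 ≤ ∑ a, p a * resolventForm t (hP a).1 (hQ a).1 := by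
  obtain ⟨Z, hZ⟩ := (isGreatest_resolventForm ht hPsum hB).1
  rw [← hZ]
  calc resolventFunctional t (∑ a, p a • P a) B Z
    _ ≤ resolventFunctional t (∑ a, p a • P a) (∑ a, p a • Q a) Z := resolventFunctional_anti h Z
    _ = ∑ a, p a * resolventFunctional t (P a) (Q a) Z := resolventFunctional_sum_smul p P Q t Z
    _ ≤ _ := Finset.sum_le_sum fun a _ => mul_le_mul_of_nonneg_left
        ((isGreatest_resolventForm ht (hP a) (hQ a)).2 ⟨Z, rfl⟩) (hp a)

/-- The integral `∫₀ʳ resolventForm t dt`, in closed form; as `r → ∞` it equals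
`D(A ‖ B) + log r tr A + o(1)`. -/
def resolventIntegral (r : ℝ) (hA : A.IsHermitian) (hB : B.IsHermitian) : ℝ :=
  jointSpectralSum hA hB fun a b => a * (Real.log (b + r * a) - Real.log b)

theorem resolventIntegral_zero (hA : A.IsHermitian) (hB : B.IsHermitian) :
    resolventIntegral 0 hA hB = 0 := by
  simp [resolventIntegral, jointSpectralSum]

theorem hasDerivAt_resolventIntegral {r : ℝ} (hr : 0 ≤ r) (hA : A.PosDef) (hB : B.PosDef) :
    HasDerivAt (fun r => resolventIntegral r hA.1 hB.1) (resolventForm r hA.1 hB.1) r := by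
  refine HasDerivAt.fun_sum fun i _ => HasDerivAt.fun_sum fun j _ => HasDerivAt.const_mul _ ?_
  have ha := hA.eigenvalues_pos i
  have hb := hB.eigenvalues_pos j
  have hne : hB.1.eigenvalues j + r * hA.1.eigenvalues i ≠ 0 := by positivity
  refine (((((hasDerivAt_id r).mul_const _).const_add _).log hne).sub_const _ |>.const_mul
    _).congr_deriv ?_
  beta_reduce
  rw [one_mul, sq, mul_div_assoc, id]

theorem tendsto_resolventIntegral_sub_log (hA : A.PosDef) (hB : B.PosDef) :
    Tendsto (fun r => resolventIntegral r hA.1 hB.1 - Real.log r * re A.trace) atTop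
      (𝓝 (relEntropy A B)) := by
  have hscale : ∀ᶠ r : ℝ in atTop,
      jointSpectralSum hA.1 hB.1 (fun a b => a * (Real.log (b * r⁻¹ + a) - Real.log b))
        = resolventIntegral r hA.1 hB.1 - Real.log r * re A.trace := by
    filter_upwards [eventually_gt_atTop 0] with r hr
    rw [re_trace_eq_jointSpectralSum_left hA.1 hB.1, resolventIntegral]
    simp only [jointSpectralSum, Finset.mul_sum, ← Finset.sum_sub_distrib]
    refine Finset.sum_congr rfl fun i _ => Finset.sum_congr rfl fun j _ => ?_
    have ha := hA.eigenvalues_pos i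
    have hb := hB.eigenvalues_pos j
    have hfactor : hB.1.eigenvalues j + r * hA.1.eigenvalues i
        = r * (hB.1.eigenvalues j * r⁻¹ + hA.1.eigenvalues i) := by field_simp
    rw [hfactor, Real.log_mul hr.ne' (by positivity)]
    ring
  refine Tendsto.congr' hscale ?_
  rw [relEntropy_eq_jointSpectralSum hA.1 hB.1]
  refine tendsto_finsetSum _ fun i _ => tendsto_finsetSum _ fun j _ =>
    Tendsto.const_mul _ (Tendsto.const_mul _ (Tendsto.sub_const ?_ _))
  refine Tendsto.log ?_ (hA.eigenvalues_pos i).ne'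
  simpa using (tendsto_inv_atTop_zero.const_mul (hB.1.eigenvalues j)).add_const
    (hA.1.eigenvalues i)

theorem resolventIntegral_sum_smul_le {r : ℝ} (hr : 0 ≤ r) (hp : ∀ a, 0 ≤ p a)
    (hP : ∀ a, (P a).PosDef) (hQ : ∀ a, (Q a).PosDef) (hPsum : (∑ a, p a • P a).PosDef)
    (hB : B.PosDef) (h : ∑ a, p a • Q a ≤ B) :
    resolventIntegral r hPsum.1 hB.1 ≤ ∑ a, p a * resolventIntegral r (hP a).1 (hQ a).1 := by
  have hd : ∀ r : ℝ, 0 ≤ r → HasDerivAt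
      (fun r => ∑ a, p a * resolventIntegral r (hP a).1 (hQ a).1
        - resolventIntegral r hPsum.1 hB.1)
      (∑ a, p a * resolventForm r (hP a).1 (hQ a).1 - resolventForm r hPsum.1 hB.1) r :=
    fun r hr => (HasDerivAt.fun_sum fun a _ =>
      (hasDerivAt_resolventIntegral hr (hP a) (hQ a)).const_mul (p a)).sub
      (hasDerivAt_resolventIntegral hr hPsum hB)
  have hmono : MonotoneOn (fun r => ∑ a, p a * resolventIntegral r (hP a).1 (hQ a).1
      - resolventIntegral r hPsum.1 hB.1) (Set.Ici 0) := by
    refine monotoneOn_of_deriv_nonneg (convex_Ici 0)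
      (fun r hr => (hd r hr).continuousAt.continuousWithinAt)
      (fun r hr => (hd r (interior_subset hr)).differentiableAt.differentiableWithinAt) ?_
    intro r hr
    have hr := interior_subset hr
    rw [(hd r hr).deriv, sub_nonneg]
    exact resolventForm_sum_smul_le hr hp hP hQ hPsum hB h
  have h0 := hmono Set.self_mem_Ici hr hr
  simpa only [resolventIntegral_zero, mul_zero, Finset.sum_const_zero, sub_self, sub_nonneg]
    using h0

/-- Lindblad's joint convexity of the relative entropy, combined with its antitonicity in the second
argument. -/
theorem relEntropy_sum_smul_le (hp : ∀ a, 0 ≤ p a) (hP : ∀ a, (P a).PosDef)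
    (hQ : ∀ a, (Q a).PosDef) (hPsum : (∑ a, p a • P a).PosDef) (hB : B.PosDef)
    (h : ∑ a, p a • Q a ≤ B) :
    relEntropy (∑ a, p a • P a) B ≤ ∑ a, p a * relEntropy (P a) (Q a) := by
  refine le_of_tendsto_of_tendsto (tendsto_resolventIntegral_sub_log hPsum hB)
    (tendsto_finsetSum _ fun a _ =>
      (tendsto_resolventIntegral_sub_log (hP a) (hQ a)).const_mul (p a)) ?_
  filter_upwards [eventually_ge_atTop 0] with r hr
  have hI := resolventIntegral_sum_smul_le hr hp hP hQ hPsum hB h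
  simp only [trace_sum, trace_smul, map_sum, smul_re, Finset.mul_sum, mul_sub,
    Finset.sum_sub_distrib, mul_left_comm (p _)]
  linarith

end Jensen

theorem cfc_log_cfc_exp (hA : A.IsHermitian) : cfc Real.log (cfc Real.exp A) = A := by
  rw [← cfc_comp Real.log Real.exp A hA.isSelfAdjoint
    ((A.finite_real_spectrum.image _).continuousOn _)]
  simp only [Function.comp_def, Real.log_exp, cfc_id' ℝ A hA.isSelfAdjoint]

theorem posDef_cfc_exp (hA : A.IsHermitian) : (cfc Real.exp A).PosDef :=
  ((cfc_isStrictlyPositive_iff Real.exp A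
    (ha := hA.isSelfAdjoint)).2 fun x _ => Real.exp_pos x).posDef

/-- Tropp's form of Lieb's concavity theorem: with `S = ∑ pₐ exp (H + Xₐ)`, Klein's inequality for
`S` and `exp (H + K)` and joint convexity of the relative entropy bound the difference of the two
sides by `∑ pₐ tr (exp (H + Xₐ) H) - tr (S H) = 0`. -/
theorem sum_mul_re_trace_cfc_exp_add_le {α : Type*} [Fintype α] {p : α → ℝ} (hp : ∀ a, 0 ≤ p a)
    (hp1 : ∑ a, p a = 1) {H K : Matrix ι ι 𝕜} {X : α → Matrix ι ι 𝕜} (hH : H.IsHermitian)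
    (hK : K.IsHermitian) (hX : ∀ a, (X a).IsHermitian)
    (h : ∑ a, p a • cfc Real.exp (X a) ≤ cfc Real.exp K) :
    ∑ a, p a * re (cfc Real.exp (H + X a)).trace ≤ re (cfc Real.exp (H + K)).trace := by
  set S := ∑ a, p a • cfc Real.exp (H + X a) with hS_def
  have hS : S.PosDef := posDef_sum_smul hp hp1 fun a => posDef_cfc_exp (hH.add (hX a))
  have hklein := re_trace_sub_le_relEntropy hS (posDef_cfc_exp (hH.add hK))
  have hconvex : relEntropy S (cfc Real.exp K)
      ≤ ∑ a, p a * relEntropy (cfc Real.exp (H + X a)) (cfc Real.exp (X a)) :=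
    relEntropy_sum_smul_le hp (fun a => posDef_cfc_exp (hH.add (hX a)))
      (fun a => posDef_cfc_exp (hX a)) hS (posDef_cfc_exp hK) h
  have hsum : ∑ a, p a * relEntropy (cfc Real.exp (H + X a)) (cfc Real.exp (X a))
      = re (S * H).trace := by
    simp only [relEntropy, cfc_log_cfc_exp (hX _), cfc_log_cfc_exp (hH.add (hX _)),
      add_sub_cancel_right, hS_def, Matrix.sum_mul, trace_sum, smul_mul_assoc, trace_smul, map_sum,
      smul_re]
  have hshift : relEntropy S (cfc Real.exp (H + K))
      = relEntropy S (cfc Real.exp K) - re (S * H).trace := by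
    rw [relEntropy, relEntropy, cfc_log_cfc_exp hK, cfc_log_cfc_exp (hH.add hK), ← map_sub,
      ← trace_sub, ← mul_sub, sub_sub, add_comm H]
  have htrace : re S.trace = ∑ a, p a * re (cfc Real.exp (H + X a)).trace := by
    simp only [hS_def, trace_sum, trace_smul, map_sum, smul_re]
  linarith

end RelativeEntropy

section Chernoff

variable {𝕜 ι : Type*} [RCLike 𝕜] [Fintype ι] [DecidableEq ι] {A : Matrix ι ι 𝕜}

theorem le_smul_one_iff_eigenvalues_le (hA : A.IsHermitian) {c : ℝ} :
    A ≤ c • (1 : Matrix ι ι 𝕜) ↔ ∀ i, hA.eigenvalues i ≤ c := by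
  rw [← Algebra.algebraMap_eq_smul_one, le_algebraMap_iff_spectrum_le,
    hA.spectrum_real_eq_range_eigenvalues, Set.forall_mem_range]

theorem re_trace_cfc (hA : A.IsHermitian) (f : ℝ → ℝ) :
    re (cfc f A).trace = ∑ i, f (hA.eigenvalues i) := by
  rw [cfc_eq_eigenvectorUnitary_mul hA, trace_mul_cycle, ← star_eq_conjTranspose,
    Unitary.coe_star_mul_self, one_mul, trace_diagonal, map_sum]
  simp only [Function.comp_apply, ofReal_re]

theorem exp_le_re_trace_cfc_exp (hA : A.IsHermitian) {c : ℝ} (h : ¬ A ≤ c • (1 : Matrix ι ι 𝕜)) :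
    Real.exp c ≤ re (cfc Real.exp A).trace := by
  rw [le_smul_one_iff_eigenvalues_le hA, not_forall] at h
  obtain ⟨i, hi⟩ := h
  rw [re_trace_cfc hA]
  exact (Real.exp_le_exp.2 (not_le.1 hi).le).trans <| Finset.single_le_sum
    (f := fun i => Real.exp (hA.eigenvalues i)) (fun _ _ => (Real.exp_pos _).le) (Finset.mem_univ i)

theorem re_trace_cfc_exp_smul_one (c : ℝ) :
    re (cfc Real.exp (c • (1 : Matrix ι ι 𝕜))).trace = Fintype.card ι * Real.exp c := by
  rw [← Algebra.algebraMap_eq_smul_one, cfc_algebraMap, Algebra.algebraMap_eq_smul_one, trace_smul,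
    trace_one, smul_re, natCast_re, mul_comm]

theorem one_add_le_cfc_exp (hA : A.IsHermitian) : 1 + A ≤ cfc Real.exp A := by
  have hlin : cfc (fun x : ℝ => 1 + x) A = 1 + A := by
    rw [cfc_const_add _ _ _ (A.finite_real_spectrum.continuousOn _) hA.isSelfAdjoint,
      cfc_id' ℝ A hA.isSelfAdjoint, map_one]
  rw [← hlin]
  refine cfc_mono (fun x _ => ?_) (A.finite_real_spectrum.continuousOn _)
    (A.finite_real_spectrum.continuousOn _)
  linarith [Real.add_one_le_exp x]

theorem exp_mul_le_chord {R x : ℝ} (hx0 : 0 ≤ x) (hxR : x ≤ R) (hR : 0 < R) (θ : ℝ) :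
    Real.exp (θ * x) ≤ 1 + (Real.exp (θ * R) - 1) / R * x := by
  have h := convexOn_exp.2 (Set.mem_univ 0) (Set.mem_univ (θ * R))
    (sub_nonneg.2 ((div_le_one hR).2 hxR)) (div_nonneg hx0 hR.le) (sub_add_cancel 1 (x / R))
  have hpoint : (1 - x / R) • (0 : ℝ) + (x / R) • (θ * R) = θ * x := by
    simp only [smul_eq_mul]
    field_simp
    ring
  rw [hpoint, Real.exp_zero] at h
  refine h.trans_eq ?_
  simp only [smul_eq_mul]
  ring

theorem cfc_exp_smul_le {R : ℝ} (hR : 0 < R) (hA0 : 0 ≤ A) (hAR : A ≤ R • (1 : Matrix ι ι 𝕜))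
    (θ : ℝ) :
    cfc Real.exp (θ • A) ≤ 1 + ((Real.exp (θ * R) - 1) / R) • A := by
  have hA : IsSelfAdjoint A := .of_nonneg hA0
  have hchord : cfc (fun x : ℝ => 1 + (Real.exp (θ * R) - 1) / R * x) A
      = 1 + ((Real.exp (θ * R) - 1) / R) • A := by
    rw [cfc_const_add _ _ _ (A.finite_real_spectrum.continuousOn _) hA,
      cfc_const_mul_id _ A hA, map_one]
  rw [← hchord, ← cfc_comp_smul θ Real.exp A ((A.finite_real_spectrum.image _).continuousOn _) hA]
  refine cfc_mono (fun x hx => ?_) (A.finite_real_spectrum.continuousOn _)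
    (A.finite_real_spectrum.continuousOn _)
  rw [← Algebra.algebraMap_eq_smul_one, le_algebraMap_iff_spectrum_le] at hAR
  exact exp_mul_le_chord (spectrum_nonneg_of_nonneg hA0 hx) (hAR x hx) hR θ

/-- This is the per-sample cumulant bound of the matrix Chernoff inequality. -/
theorem sum_smul_cfc_exp_smul_le {α : Type*} [Fintype α] {p : α → ℝ} (hp : ∀ a, 0 ≤ p a)
    (hp1 : ∑ a, p a = 1) {X : α → Matrix ι ι 𝕜} {R : ℝ} (hR : 0 < R) (hX0 : ∀ a, 0 ≤ X a)
    (hXR : ∀ a, X a ≤ R • (1 : Matrix ι ι 𝕜)) (θ : ℝ) :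
    ∑ a, p a • cfc Real.exp (θ • X a)
      ≤ cfc Real.exp (((Real.exp (θ * R) - 1) / R) • ∑ a, p a • X a) := by
  have hmean : IsSelfAdjoint (∑ a, p a • X a) :=
    .of_nonneg (Finset.sum_nonneg fun a _ => smul_nonneg (hp a) (hX0 a))
  calc ∑ a, p a • cfc Real.exp (θ • X a)
    _ ≤ ∑ a, p a • (1 + ((Real.exp (θ * R) - 1) / R) • X a) :=
        Finset.sum_le_sum fun a _ =>
          smul_le_smul_of_nonneg_left (cfc_exp_smul_le hR (hX0 a) (hXR a) θ) (hp a)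
    _ = 1 + ((Real.exp (θ * R) - 1) / R) • ∑ a, p a • X a := by
        simp only [smul_add, Finset.sum_add_distrib, ← Finset.sum_smul, hp1, one_smul,
          Finset.smul_sum, smul_comm _ (p _)]
    _ ≤ _ := one_add_le_cfc_exp ((IsSelfAdjoint.all _).smul hmean)

section Probability

variable {α γ Ω : Type*} [MeasurableSpace α] [MeasurableSpace γ] [MeasurableSpace Ω]
  {μ : Measure Ω}

theorem IsIndependentSample.nonneg {J : Type*} {p : J → α → ℝ} {ω : J → Ω → α}
    (hω : IsIndependentSample μ p ω) (j : J) (a : α) : 0 ≤ p j a :=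
  hω.2.2 j a ▸ measureReal_nonneg

variable [Fintype α] [MeasurableSingletonClass α]

theorem integral_comp_eq_sum_of_indepFun {x : Ω → α} {y : Ω → γ} (hxy : IndepFun x y μ)
    (hx : Measurable x) (hy : Measurable y) {F : α → γ → ℝ} (hF : ∀ a, Measurable (F a))
    (hint : ∀ a, Integrable (fun z => F a (y z)) μ) :
    ∫ z, F (x z) (y z) ∂μ = ∑ a, μ.real (x ⁻¹' {a}) * ∫ z, F a (y z) ∂μ := by
  classical
  have hindicator (a : α) : Measurable (({a} : Set α).indicator (1 : α → ℝ)) :=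
    measurable_one.indicator (measurableSet_singleton a)
  have hsplit : (fun z => F (x z) (y z))
      = fun z => ∑ a, ({a} : Set α).indicator 1 (x z) * F a (y z) := by
    ext z
    simp [Set.indicator_apply]
  rw [hsplit, integral_finsetSum]
  · refine Finset.sum_congr rfl fun a _ => ?_
    rw [hxy.integral_fun_comp_mul_comp hx.aemeasurable hy.aemeasurable
      (hindicator a).aestronglyMeasurable (hF a).aestronglyMeasurable]
    congr 1
    rw [← integral_indicator_one (hx (measurableSet_singleton a))]
    rfl
  · intro a _
    refine (hint a).bdd_mul (c := 1) ((hindicator a).comp hx).aestronglyMeasurable ?_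
    refine ae_of_all _ fun z => ?_
    simp only [Set.indicator_apply]
    split_ifs <;> simp

namespace IsIndependentSample

variable {J : Type*} {p : J → α → ℝ} {ω : J → Ω → α}

theorem sum_eq_one [IsProbabilityMeasure μ] (hω : IsIndependentSample μ p ω) (j : J) :
    ∑ a, p j a = 1 := by
  simp only [← hω.2.2 j]
  rw [sum_measureReal_preimage_singleton _ fun a _ => hω.1 j (measurableSet_singleton a),
    Finset.coe_univ, Set.preimage_univ, probReal_univ]

theorem integral_insert [IsFiniteMeasure μ] (hω : IsIndependentSample μ p ω)
    {j : J} {s : Finset J} (hj : j ∉ s) (F : α → (s → α) → ℝ) :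
    ∫ z, F (ω j z) (fun i => ω i z) ∂μ = ∑ a, p j a * ∫ z, F a (fun i : s => ω i z) ∂μ := by
  classical
  have hindep : IndepFun (ω j) (fun z (i : s) => ω i z) μ :=
    (hω.2.1.indepFun_finset {j} s (Finset.disjoint_singleton_left.2 hj) hω.1).comp
      (measurable_pi_apply (⟨j, Finset.mem_singleton_self j⟩ : ({j} : Finset J))) measurable_id
  have hy : Measurable fun z (i : s) => ω i z := measurable_pi_lambda _ fun i => hω.1 i
  simp only [← hω.2.2]
  exact integral_comp_eq_sum_of_indepFun hindep (hω.1 j) hy (fun a => .of_discrete)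
    fun a => Integrable.of_finite.comp_measurable hy

theorem integral_re_trace_cfc_exp_add_le [IsProbabilityMeasure μ] (hω : IsIndependentSample μ p ω)
    {X : J → α → Matrix ι ι 𝕜} {R : ℝ} (hR : 0 < R) (hX0 : ∀ j a, 0 ≤ X j a)
    (hXR : ∀ j a, X j a ≤ R • (1 : Matrix ι ι 𝕜)) (θ : ℝ) (s : Finset J) {H : Matrix ι ι 𝕜}
    (hH : H.IsHermitian) :
    ∫ z, re (cfc Real.exp (H + θ • ∑ j ∈ s, X j (ω j z))).trace ∂μ
      ≤ re (cfc Real.exp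
          (H + ((Real.exp (θ * R) - 1) / R) • ∑ j ∈ s, ∑ a, p j a • X j a)).trace := by
  classical
  have hherm (r : ℝ) {A : Matrix ι ι 𝕜} (hA : 0 ≤ A) : (r • A).IsHermitian :=
    (IsSelfAdjoint.all r).smul (.of_nonneg hA)
  have hmean (j : J) : 0 ≤ ∑ a, p j a • X j a :=
    Finset.sum_nonneg fun a _ => smul_nonneg (hω.nonneg j a) (hX0 j a)
  induction s using Finset.induction_on generalizing H with
  | empty => simp
  | insert j s hj ih =>
    set g := (Real.exp (θ * R) - 1) / R
    have hcoe (z : Ω) : ∑ i : s, X i (ω i z) = ∑ i ∈ s, X i (ω i z) :=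
      Finset.sum_coe_sort s fun i => X i (ω i z)
    have hsum (z : Ω) : H + θ • ∑ i ∈ insert j s, X i (ω i z)
        = H + θ • X j (ω j z) + θ • ∑ i : s, X i (ω i z) := by
      rw [Finset.sum_insert hj, smul_add, add_assoc, hcoe]
    simp only [hsum]
    rw [hω.integral_insert hj fun a y => re (cfc Real.exp
      (H + θ • X j a + θ • ∑ i : s, X i (y i))).trace]
    calc ∑ a, p j a * ∫ z, re (cfc Real.exp (H + θ • X j a + θ • ∑ i : s, X i (ω i z))).trace ∂μ
      _ ≤ ∑ a, p j a * re (cfc Real.exp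
            (H + g • (∑ i ∈ s, ∑ b, p i b • X i b) + θ • X j a)).trace := by
          refine Finset.sum_le_sum fun a _ => mul_le_mul_of_nonneg_left ?_ (hω.nonneg j a)
          rw [add_right_comm]
          simp only [hcoe]
          exact ih (hH.add (hherm θ (hX0 j a)))
      _ ≤ re (cfc Real.exp
            (H + g • (∑ i ∈ s, ∑ b, p i b • X i b) + g • ∑ a, p j a • X j a)).trace :=
          sum_mul_re_trace_cfc_exp_add_le (hω.nonneg j) (hω.sum_eq_one j)
            (hH.add (hherm g (Finset.sum_nonneg fun i _ => hmean i))) (hherm g (hmean j))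
            (fun a => hherm θ (hX0 j a))
            (sum_smul_cfc_exp_smul_le (hω.nonneg j) (hω.sum_eq_one j) hR (hX0 j) (hXR j) θ)
      _ = _ := by
          rw [Finset.sum_insert hj, add_assoc, ← smul_add, add_comm (∑ i ∈ s, _)]

variable [Fintype J]

/-- The Laplace transform method: Markov's inequality for `tr exp (θ ∑ⱼ Xⱼ)`. -/
theorem measureReal_not_le_smul_one_le [IsProbabilityMeasure μ] (hω : IsIndependentSample μ p ω)
    {X : J → α → Matrix ι ι 𝕜} {R : ℝ} (hR : 0 < R) (hX0 : ∀ j a, 0 ≤ X j a)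
    (hXR : ∀ j a, X j a ≤ R • (1 : Matrix ι ι 𝕜)) (hmean : ∑ j, ∑ a, p j a • X j a = 1)
    (θ c : ℝ) :
    μ.real {z | ¬ θ • ∑ j, X j (ω j z) ≤ c • (1 : Matrix ι ι 𝕜)}
      ≤ Fintype.card ι * Real.exp ((Real.exp (θ * R) - 1) / R - c) := by
  have hherm (z : Ω) : (θ • ∑ j, X j (ω j z)).IsHermitian :=
    (IsSelfAdjoint.all θ).smul (.of_nonneg (Finset.sum_nonneg fun j _ => hX0 j _))
  have hmgf := hω.integral_re_trace_cfc_exp_add_le hR hX0 hXR θ Finset.univ isHermitian_zero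
  simp only [zero_add, hmean, re_trace_cfc_exp_smul_one] at hmgf
  have hint : Integrable (fun z => re (cfc Real.exp (θ • ∑ j, X j (ω j z))).trace) μ := by
    have hy : Measurable fun z j => ω j z := measurable_pi_lambda _ hω.1
    exact (Integrable.of_finite (f := fun y : J → α =>
      re (cfc Real.exp (θ • ∑ j, X j (y j))).trace)).comp_measurable hy
  have hmarkov := mul_meas_ge_le_integral_of_nonneg
    (ae_of_all μ fun z => (re_trace_cfc (hherm z) Real.exp).symm ▸
      Finset.sum_nonneg fun i _ => (Real.exp_pos _).le) hint (Real.exp c)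
  rw [Real.exp_sub, ← mul_div_assoc, le_div_iff₀' (Real.exp_pos c)]
  refine (mul_le_mul_of_nonneg_left (measureReal_mono fun z hz => ?_)
    (Real.exp_pos c).le).trans (hmarkov.trans hmgf)
  exact exp_le_re_trace_cfc_exp (hherm z) hz

end IsIndependentSample

theorem sub_one_add_mul_log_le {η : ℝ} (h1 : -1 < η) (h1' : η ≤ 1) :
    η - (1 + η) * Real.log (1 + η) ≤ -(η ^ 2 / 3) := by
  have hpos : 0 < 1 + η := by linarith
  rcases le_total 0 η with h0 | h0
  · have h := mul_le_mul_of_nonneg_left (Real.le_log_one_add_of_nonneg h0) hpos.le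
    have hsplit : (1 + η) * (2 * η / (η + 2)) = η + η ^ 2 / (η + 2) := by
      field_simp
      ring
    have : η ^ 2 / 3 ≤ η ^ 2 / (η + 2) := by gcongr; linarith
    linarith
  · have hsinh : -Real.log (1 + η) ≤ ((1 + η)⁻¹ - (1 + η)) / 2 := by
      have h := Real.sinh_log (inv_pos.2 hpos)
      rw [inv_inv, Real.log_inv] at h
      rw [← h, Real.self_le_sinh_iff, neg_nonneg]
      exact Real.log_nonpos hpos.le (by linarith)
    have h := mul_le_mul_of_nonneg_left hsinh hpos.le
    have hsplit : (1 + η) * (((1 + η)⁻¹ - (1 + η)) / 2) = -η - η ^ 2 / 2 := by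
      field_simp
      ring
    nlinarith [sq_nonneg η]

namespace IsIndependentSample

variable {J : Type*} [Fintype J] {p : J → α → ℝ} {ω : J → Ω → α}

theorem measureReal_not_chernoff_le [IsProbabilityMeasure μ] (hω : IsIndependentSample μ p ω)
    {X : J → α → Matrix ι ι 𝕜} {R : ℝ} (hR : 0 < R) (hX0 : ∀ j a, 0 ≤ X j a)
    (hXR : ∀ j a, X j a ≤ R • (1 : Matrix ι ι 𝕜)) (hmean : ∑ j, ∑ a, p j a • X j a = 1)
    {η : ℝ} (hη : -1 < η) (hη' : η ≤ 1) :
    μ.real {z | ¬ (Real.log (1 + η) / R) • ∑ j, X j (ω j z)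
        ≤ (Real.log (1 + η) / R * (1 + η)) • (1 : Matrix ι ι 𝕜)}
      ≤ Fintype.card ι * Real.exp (-(η ^ 2 / (3 * R))) := by
  refine (hω.measureReal_not_le_smul_one_le hR hX0 hXR hmean _ _).trans ?_
  gcongr
  rw [div_mul_cancel₀ _ hR.ne', Real.exp_log (by linarith), ← div_div]
  calc (1 + η - 1) / R - Real.log (1 + η) / R * (1 + η)
    _ = (η - (1 + η) * Real.log (1 + η)) / R := by ring
    _ ≤ -(η ^ 2 / 3) / R := by gcongr; exact sub_one_add_mul_log_le hη hη'
    _ = -(η ^ 2 / 3 / R) := neg_div _ _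

/-- The matrix Chernoff inequality. -/
theorem one_sub_le_measureReal_sum_mem_Icc [IsProbabilityMeasure μ]
    (hω : IsIndependentSample μ p ω)
    {X : J → α → Matrix ι ι 𝕜} {R : ℝ} (hR : 0 < R) (hX0 : ∀ j a, 0 ≤ X j a)
    (hXR : ∀ j a, X j a ≤ R • (1 : Matrix ι ι 𝕜)) (hmean : ∑ j, ∑ a, p j a • X j a = 1)
    {δ : ℝ} (hδ0 : 0 < δ) (hδ1 : δ < 1) :
    1 - 2 * Fintype.card ι * Real.exp (-(δ ^ 2 / (3 * R)))
      ≤ μ.real {z | ∑ j, X j (ω j z) ∈ Set.Icc ((1 - δ) • 1) ((1 + δ) • 1)} := by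
  have hupper := hω.measureReal_not_chernoff_le hR hX0 hXR hmean (η := δ) (by linarith) hδ1.le
  have hlower := hω.measureReal_not_chernoff_le hR hX0 hXR hmean (η := -δ) (by linarith)
    (by linarith)
  rw [neg_sq, ← sub_eq_add_neg] at hlower
  have hsubset : {z | ∑ j, X j (ω j z) ∈ Set.Icc ((1 - δ) • 1) ((1 + δ) • 1)}ᶜ
      ⊆ {z | ¬ (Real.log (1 - δ) / R) • ∑ j, X j (ω j z)
          ≤ (Real.log (1 - δ) / R * (1 - δ)) • (1 : Matrix ι ι 𝕜)}
        ∪ {z | ¬ (Real.log (1 + δ) / R) • ∑ j, X j (ω j z)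
          ≤ (Real.log (1 + δ) / R * (1 + δ)) • (1 : Matrix ι ι 𝕜)} := by
    have hlog : 0 < Real.log (1 + δ) / R := div_pos (Real.log_pos (by linarith)) hR
    have hlog' : Real.log (1 - δ) / R < 0 :=
      div_neg_of_neg_of_pos (Real.log_neg (by linarith) (by linarith)) hR
    intro z hz
    simp only [Set.mem_compl_iff, Set.mem_union, Set.mem_ofPred_eq, mul_smul, Set.mem_Icc,
      smul_le_smul_iff_of_pos_left hlog, smul_le_smul_iff_of_neg_left hlog'] at hz ⊢
    exact not_and_or.1 hz
  have hmeas : MeasurableSet {z | ∑ j, X j (ω j z) ∈ Set.Icc ((1 - δ) • 1) ((1 + δ) • 1)} := by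
    have hy : Measurable fun z j => ω j z := measurable_pi_lambda _ hω.1
    exact hy (MeasurableSet.of_discrete
      (s := {y : J → α | ∑ j, X j (y j) ∈ Set.Icc ((1 - δ) • 1) ((1 + δ) • 1)}))
  have hcompl := (measureReal_mono (μ := μ) hsubset).trans (measureReal_union_le _ _)
  rw [probReal_compl_eq_one_sub hmeas] at hcompl
  linarith

end IsIndependentSample

end Probability

end Chernoff


section Gram

variable {κ ι : Type*} [Fintype κ]

theorem isHermitian_transpose_mul_self (M : Matrix κ ι ℝ) : (Mᵀ * M).IsHermitian :=
  conjTranspose_eq_transpose_of_trivial M ▸ isHermitian_conjTranspose_mul_self M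

theorem isHermitian_smul_one [DecidableEq ι] (c : ℝ) : (c • (1 : Matrix ι ι ℝ)).IsHermitian :=
  (IsSelfAdjoint.all c).smul isHermitian_one

variable [Fintype ι]

theorem le_iff_dotProduct_mulVec_le {A B : Matrix ι ι ℝ} (hA : A.IsHermitian)
    (hB : B.IsHermitian) : A ≤ B ↔ ∀ w, w ⬝ᵥ A *ᵥ w ≤ w ⬝ᵥ B *ᵥ w := by
  rw [Matrix.le_iff, posSemidef_iff_dotProduct_mulVec, and_iff_right (hB.sub hA)]
  simp only [star_trivial, sub_mulVec, dotProduct_sub, sub_nonneg]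

theorem dotProduct_transpose_mul_self_mulVec (M : Matrix κ ι ℝ) (w : ι → ℝ) :
    w ⬝ᵥ (Mᵀ * M) *ᵥ w = ‖WithLp.toLp 2 (M *ᵥ w)‖ ^ 2 := by
  rw [dotProduct_mulVec, ← vecMul_mulVec, ← dotProduct_mulVec, EuclideanSpace.real_norm_sq_eq]
  exact Finset.sum_congr rfl fun _ _ => (sq _).symm

variable [DecidableEq ι]

theorem dotProduct_smul_one_mulVec (c : ℝ) (w : ι → ℝ) :
    w ⬝ᵥ (c • (1 : Matrix ι ι ℝ)) *ᵥ w = c * ‖WithLp.toLp 2 w‖ ^ 2 := by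
  have hone := dotProduct_transpose_mul_self_mulVec (1 : Matrix ι ι ℝ) w
  rw [transpose_one, mul_one, one_mulVec] at hone
  rw [smul_mulVec, dotProduct_smul, smul_eq_mul, one_mulVec, hone]

theorem transpose_mul_self_le_smul_one_iff {M : Matrix κ ι ℝ} {c : ℝ} :
    Mᵀ * M ≤ c • 1 ↔ ∀ w, ‖WithLp.toLp 2 (M *ᵥ w)‖ ^ 2 ≤ c * ‖WithLp.toLp 2 w‖ ^ 2 := by
  rw [le_iff_dotProduct_mulVec_le (isHermitian_transpose_mul_self M)
    (isHermitian_smul_one c)]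
  simp only [dotProduct_transpose_mul_self_mulVec, dotProduct_smul_one_mulVec]

theorem smul_one_le_transpose_mul_self_iff {M : Matrix κ ι ℝ} {c : ℝ} :
    c • 1 ≤ Mᵀ * M ↔ ∀ w, c * ‖WithLp.toLp 2 w‖ ^ 2 ≤ ‖WithLp.toLp 2 (M *ᵥ w)‖ ^ 2 := by
  rw [le_iff_dotProduct_mulVec_le (isHermitian_smul_one c)
    (isHermitian_transpose_mul_self M)]
  simp only [dotProduct_transpose_mul_self_mulVec, dotProduct_smul_one_mulVec]

end Gram

theorem fT_sq (T : ℕ) (l : ℝ) : fT T l ^ 2 = ∑ t ∈ Finset.range T, l ^ (2 * t) :=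
  Real.sq_sqrt (Finset.sum_nonneg fun t _ => (even_two_mul t).pow_nonneg l)

theorem fT_pos {T : ℕ} (hT : 0 < T) (l : ℝ) : 0 < fT T l :=
  Real.sqrt_pos.2 <| Finset.sum_pos' (fun t _ => (even_two_mul t).pow_nonneg l)
    ⟨0, Finset.mem_range.2 hT, by simp⟩

theorem fT_sq_le_fT_sq (T : ℕ) {l l' : ℝ} (hl : 0 ≤ l) (h : l ≤ l') : fT T l ^ 2 ≤ fT T l' ^ 2 := by
  rw [fT_sq, fT_sq]
  gcongr

section Spectral

variable {n : ℕ} {G : WeightedGraph n} (E : G.EigenDecomposition) (Δt : ℝ)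

theorem eigA_nonneg (i : Fin n) : 0 ≤ eigA E Δt i := (Real.exp_pos _).le

theorem eigA_antitone {Δt : ℝ} (hΔt : 0 ≤ Δt) : Antitone (eigA E Δt) := fun _ _ hij =>
  Real.exp_le_exp.2 (neg_le_neg (mul_le_mul_of_nonneg_left (E.monotone hij) hΔt))

namespace WeightedGraph.EigenDecomposition

theorem transpose_mul_self : E.Uᵀ * E.U = 1 :=
  (Matrix.mem_orthogonalGroup_iff' (Fin n) ℝ).1 E.orthogonal

theorem semiconjBy_heat : SemiconjBy E.U (diagonal (eigA E Δt)) (G.heat Δt) := by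
  have hinv : E.U⁻¹ = E.Uᵀ := inv_eq_left_inv E.transpose_mul_self
  have hunit : IsUnit E.U := (isUnit_iff_isUnit_det _).2 (isUnit_det_of_left_inverse
    E.transpose_mul_self)
  have hlog : -(Δt • G.laplacian) = E.U * diagonal (fun i => -(Δt * E.σ i)) * E.U⁻¹ := by
    rw [E.decomp, hinv, ← neg_smul, ← smul_mul_assoc, ← mul_smul_comm, ← diagonal_smul]
    simp only [Pi.smul_def, smul_eq_mul, neg_mul]
  have heat_eq : G.heat Δt = E.U * diagonal (eigA E Δt) * E.Uᵀ := by
    rw [heat, hlog, Matrix.exp_conj _ _ hunit, exp_diagonal, hinv, Pi.exp_def]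
    simp only [← Real.exp_eq_exp_ℝ]
    rfl
  rw [SemiconjBy, heat_eq, Matrix.mul_assoc _ E.Uᵀ, E.transpose_mul_self, Matrix.mul_one]

theorem heat_pow_mul_apply (t : ℕ) (i l : Fin n) :
    (G.heat Δt ^ t * E.U) i l = eigA E Δt l ^ t * E.U i l := by
  rw [← ((E.semiconjBy_heat Δt).pow_right t).eq, diagonal_pow, mul_diagonal, mul_comm, Pi.pow_apply]

/-- The matrix `U_k = (u_1, …, u_k)` of the first `k` eigenvectors. -/
def lowModes {k : ℕ} (hk : k ≤ n) : Matrix (Fin n) (Fin k) ℝ := E.U.submatrix id (Fin.castLE hk)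

variable {k : ℕ} (hk : k ≤ n)

theorem lowModes_transpose_mul_self : (E.lowModes hk)ᵀ * E.lowModes hk = 1 := by
  rw [lowModes, transpose_submatrix, ← submatrix_mul _ _ _ _ _ Function.bijective_id,
    E.transpose_mul_self, submatrix_one _ (Fin.castLE_injective hk)]

theorem norm_sq_lowModes_mulVec (c : Fin k → ℝ) :
    ‖WithLp.toLp 2 (E.lowModes hk *ᵥ c)‖ ^ 2 = ‖WithLp.toLp 2 c‖ ^ 2 := by
  rw [← dotProduct_transpose_mul_self_mulVec, lowModes_transpose_mul_self, ← one_smul ℝ 1,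
    dotProduct_smul_one_mulVec, one_mul]

theorem exists_eq_lowModes_mulVec_of_mem_bandlimited {x : EuclideanSpace ℝ (Fin n)}
    (hx : x ∈ bandlimited E hk) : ∃ c, x = WithLp.toLp 2 (E.lowModes hk *ᵥ c) := by
  obtain ⟨c, rfl⟩ := (Submodule.mem_span_range_iff_exists_fun ℝ).1 hx
  refine ⟨c, ?_⟩
  ext i
  simp [lowModes, mulVec, dotProduct, mul_comm]

end WeightedGraph.EigenDecomposition

variable {T k : ℕ} (hk : k ≤ n)

theorem trajectory_lowModes_mulVec (hT : 0 < T) (c : Fin k → ℝ) :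
    (trajectory (G.heat Δt) T (WithLp.toLp 2 (E.lowModes hk *ᵥ c))).ofLp
      = Utilde E Δt T hk *ᵥ fun l => fT T (eigA E Δt (Fin.castLE hk l)) * c l := by
  funext s
  have hcol (l : Fin k) : (G.heat Δt ^ (s.1 : ℕ) * E.lowModes hk) s.2 l
      = eigA E Δt (Fin.castLE hk l) ^ (s.1 : ℕ) * E.U s.2 (Fin.castLE hk l) :=
    E.heat_pow_mul_apply Δt s.1 s.2 (Fin.castLE hk l)
  simp only [trajectory, mulVec_mulVec]
  simp only [mulVec, dotProduct, hcol, Utilde, of_apply]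
  refine Finset.sum_congr rfl fun l _ => ?_
  have hpos := (fT_pos hT (eigA E Δt (Fin.castLE hk l))).ne'
  field_simp

theorem Utilde_transpose_mul_self (hT : 0 < T) :
    (Utilde E Δt T hk)ᵀ * Utilde E Δt T hk = 1 := by
  ext l l'
  set a := eigA E Δt (Fin.castLE hk l)
  set b := eigA E Δt (Fin.castLE hk l')
  have hfactor : ((Utilde E Δt T hk)ᵀ * Utilde E Δt T hk) l l'
      = (∑ t : Fin T, a ^ (t : ℕ) * b ^ (t : ℕ)) / (fT T a * fT T b)
        * ((E.lowModes hk)ᵀ * E.lowModes hk) l l' := by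
    rw [Matrix.mul_apply, Fintype.sum_sigma, Finset.sum_div, Finset.sum_mul]
    refine Finset.sum_congr rfl fun t _ => ?_
    rw [Matrix.mul_apply, Finset.mul_sum]
    refine Finset.sum_congr rfl fun i _ => ?_
    simp only [transpose_apply, Utilde, of_apply, WeightedGraph.EigenDecomposition.lowModes,
      submatrix_apply, id_eq]
    ring
  rw [hfactor, E.lowModes_transpose_mul_self]
  obtain rfl | hll := eq_or_ne l l'
  · have hsum : ∑ t : Fin T, a ^ (t : ℕ) * a ^ (t : ℕ) = fT T a ^ 2 := by
      simp only [fT_sq, ← pow_add, ← two_mul, Fin.sum_univ_eq_sum_range fun t => a ^ (2 * t)]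
    rw [hsum, ← sq, div_self (pow_ne_zero 2 (fT_pos hT a).ne'), one_mul]
  · rw [one_apply_ne hll, mul_zero]

theorem stablyEmbeds_of_gram_mem_Icc {ρ : Type*} [Fintype ρ] (hT : 0 < T) (hk0 : 0 < k)
    {Δt : ℝ} (hΔt : 0 ≤ Δt) {δ : ℝ} (hδ0 : 0 ≤ 1 + δ) (hδ1 : 0 ≤ 1 - δ)
    {B : Matrix ρ (SpaceTime T n) ℝ}
    (h : (B * Utilde E Δt T hk)ᵀ * (B * Utilde E Δt T hk) ∈ Set.Icc ((1 - δ) • 1) ((1 + δ) • 1)) :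
    StablyEmbeds E Δt hk0 hk δ B := by
  intro x hx
  obtain ⟨c, rfl⟩ := E.exists_eq_lowModes_mulVec_of_mem_bandlimited hk hx
  set w : Fin k → ℝ := fun l => fT T (eigA E Δt (Fin.castLE hk l)) * c l
  have hlo := smul_one_le_transpose_mul_self_iff.1 h.1 w
  have hhi := transpose_mul_self_le_smul_one_iff.1 h.2 w
  have hw : ‖WithLp.toLp 2 w‖ ^ 2 = ∑ l, fT T (eigA E Δt (Fin.castLE hk l)) ^ 2 * c l ^ 2 := by
    simp only [EuclideanSpace.real_norm_sq_eq, w, mul_pow]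
  have hmono (i j : Fin n) (hij : i ≤ j) : fT T (eigA E Δt j) ^ 2 ≤ fT T (eigA E Δt i) ^ 2 :=
    fT_sq_le_fT_sq T (eigA_nonneg E Δt j) (eigA_antitone E hΔt hij)
  have hc (a : ℝ) : a * ‖WithLp.toLp 2 c‖ ^ 2 = ∑ l, a * c l ^ 2 := by
    rw [EuclideanSpace.real_norm_sq_eq, Finset.mul_sum]
  rw [E.norm_sq_lowModes_mulVec, trajectory_lowModes_mulVec E Δt hk hT, mulVec_mulVec,
    mul_assoc, mul_assoc, hc, hc]
  rw [hw] at hlo hhi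
  constructor
  · refine (mul_le_mul_of_nonneg_left (Finset.sum_le_sum fun l _ => ?_) hδ1).trans hlo
    exact mul_le_mul_of_nonneg_right (hmono _ _ (Nat.le_sub_one_of_lt l.2)) (sq_nonneg _)
  · refine hhi.trans (mul_le_mul_of_nonneg_left (Finset.sum_le_sum fun l _ => ?_) hδ0)
    exact mul_le_mul_of_nonneg_right (hmono _ _ (Nat.zero_le l)) (sq_nonneg _)

end Spectral

section RowGram

variable {κ ι : Type*}

/-- The rank-one matrix `Mᵀ δ_s δ_sᵀ M`, the contribution of the row `s` to the Gram matrix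
`Mᵀ M`. -/
def rowGram (M : Matrix κ ι ℝ) (s : κ) : Matrix ι ι ℝ := vecMulVec (M s) (M s)

theorem sum_rowGram [Fintype κ] (M : Matrix κ ι ℝ) : ∑ s, rowGram M s = Mᵀ * M := by
  ext i j
  rw [Matrix.sum_apply, Matrix.mul_apply]
  rfl

theorem rowGram_nonneg [Finite ι] (M : Matrix κ ι ℝ) (s : κ) : 0 ≤ rowGram M s :=
  Matrix.nonneg_iff_posSemidef.2 (posSemidef_vecMulVec_self_star (M s))

variable [Fintype ι] [DecidableEq ι]

theorem rowGram_le_norm_sq_smul_one (M : Matrix κ ι ℝ) (s : κ) :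
    rowGram M s ≤ ‖WithLp.toLp 2 (M s)‖ ^ 2 • 1 := by
  refine (le_iff_dotProduct_mulVec_le (IsSelfAdjoint.of_nonneg (rowGram_nonneg M s))
    (isHermitian_smul_one _)).2 fun w => ?_
  rw [dotProduct_smul_one_mulVec, rowGram, vecMulVec_mulVec, dotProduct_smul, dotProduct_comm w,
    EuclideanSpace.real_norm_sq_eq, EuclideanSpace.real_norm_sq_eq]
  exact (sq _).symm.trans_le (Finset.sum_mul_sq_le_sq_mul_sq Finset.univ (M s) w)

open scoped Matrix.Norms.L2Operator in
theorem transpose_mul_self_le_norm_sq_smul_one [Fintype κ] (M : Matrix κ ι ℝ) :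
    Mᵀ * M ≤ ‖M‖ ^ 2 • 1 := by
  classical
  rw [transpose_mul_self_le_smul_one_iff]
  intro w
  rw [← mul_pow]
  exact pow_le_pow_left₀ (norm_nonneg _) (l2_opNorm_mulVec M (WithLp.toLp 2 w)) 2

end RowGram

section SamplingOperator

variable {ρ κ ι : Type*}

theorem selection_mul [Fintype κ] [DecidableEq κ] (s : ρ → κ) (M : Matrix κ ι ℝ) :
    selection s * M = M.submatrix s id := by
  ext r i
  simp [selection, Matrix.mul_apply]

theorem sampledProb_diagonal_selection [DecidableEq ρ] [Fintype κ] [DecidableEq κ] (q : κ → ℝ)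
    (s : ρ → κ) : sampledProb (diagonal q) (selection s) = diagonal fun r => q (s r) := by
  rw [sampledProb, selection_mul]
  congr 1
  funext r
  simp [selection, Matrix.mul_apply, diagonal_apply]

theorem samplingOp_diagonal_selection_mul [Fintype ρ] [DecidableEq ρ] [Fintype κ] [DecidableEq κ]
    {q : κ → ℝ} (hq : ∀ a, 0 ≤ q a) (W : Matrix ρ ρ ℝ) (s : ρ → κ) (M : Matrix κ ι ℝ) :
    samplingOp (diagonal q) W (selection s) * M
      = diagonal (fun r => √(W r r / q (s r))) * M.submatrix s id := by
  rw [samplingOp, sampledProb_diagonal_selection, Matrix.mul_assoc, selection_mul, diagPow, diagPow,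
    diagonal_mul_diagonal]
  congr 2
  funext r
  rw [diagonal_apply_eq, Real.rpow_neg (hq _), ← Real.sqrt_eq_rpow, ← Real.sqrt_eq_rpow,
    Real.sqrt_div' _ (hq _), inv_mul_eq_div]

theorem gram_samplingOp_diagonal_selection [Fintype ρ] [DecidableEq ρ] [Fintype κ] [DecidableEq κ]
    {q : κ → ℝ} (hq : ∀ a, 0 ≤ q a) {W : Matrix ρ ρ ℝ} (hW : ∀ r, 0 ≤ W r r) (s : ρ → κ)
    (M : Matrix κ ι ℝ) :
    (samplingOp (diagonal q) W (selection s) * M)ᵀ * (samplingOp (diagonal q) W (selection s) * M)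
      = ∑ r, (W r r / q (s r)) • rowGram M (s r) := by
  rw [samplingOp_diagonal_selection_mul hq, ← sum_rowGram]
  refine Finset.sum_congr rfl fun r _ => ?_
  ext i j
  have hsq := Real.mul_self_sqrt (div_nonneg (hW r) (hq (s r)))
  simp only [rowGram, vecMulVec_apply, diagonal_mul, submatrix_apply, id_eq, Matrix.smul_apply,
    smul_eq_mul]
  rw [mul_mul_mul_comm, hsq]

theorem blockDiagonal'_selection {o : Type*} [DecidableEq o] {m α : o → Type*}
    [∀ t, DecidableEq (α t)] (ω : ∀ t, m t → α t) :
    (blockDiagonal' fun t => selection (ω t))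
      = selection fun r : Σ t, m t => (⟨r.1, ω r.1 r.2⟩ : Σ t, α t) := by
  ext ⟨t, j⟩ ⟨t', i⟩
  obtain rfl | h := eq_or_ne t t'
  · simp [selection]
  · rw [blockDiagonal'_apply_ne _ _ _ h, selection, of_apply,
      if_neg fun e => h (congrArg Sigma.fst e).symm]

variable {n T : ℕ}

theorem gram_samplingOp₁ {m : ℕ} {p : Fin n → ℝ} (hp : ∀ i, 0 ≤ p i) (ω : Fin m → Fin n)
    (M : Matrix (SpaceTime T n) ι ℝ) :
    (samplingOp₁ (T := T) p ω * M)ᵀ * (samplingOp₁ (T := T) p ω * M)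
      = ∑ j, (1 / (m : ℝ) / p (ω j)) • ∑ t, rowGram M ⟨t, ω j⟩ := by
  have hW (r : Σ _ : Fin T, Fin m) :
      0 ≤ ((1 / (m : ℝ)) • (1 : Matrix (Σ _ : Fin T, Fin m) (Σ _ : Fin T, Fin m) ℝ)) r r := by
    simp
  rw [samplingOp₁, blockDiagonal'_diagonal, blockDiagonal'_selection fun _ => ω,
    gram_samplingOp_diagonal_selection (q := fun s : SpaceTime T n => p s.2) (fun s => hp s.2) hW,
    Fintype.sum_sigma, Finset.sum_comm]
  simp only [Finset.smul_sum, Matrix.smul_apply, one_apply_eq, smul_eq_mul, mul_one]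

theorem gram_samplingOp₂ {m : Fin T → ℕ} {p : Fin T → Fin n → ℝ} (hp : ∀ t i, 0 ≤ p t i)
    (ω : (Σ t, Fin (m t)) → Fin n) (M : Matrix (SpaceTime T n) ι ℝ) :
    (samplingOp₂ p ω * M)ᵀ * (samplingOp₂ p ω * M)
      = ∑ r, (1 / (m r.1 : ℝ) / p r.1 (ω r)) • rowGram M ⟨r.1, ω r⟩ := by
  have hdiag (r : Σ t, Fin (m t)) : blockDiagonal'
      (fun t => (1 / (m t : ℝ)) • (1 : Matrix (Fin (m t)) (Fin (m t)) ℝ)) r r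
        = 1 / (m r.1 : ℝ) := by
    obtain ⟨t, j⟩ := r
    rw [blockDiagonal'_apply_eq, Matrix.smul_apply, one_apply_eq, smul_eq_mul, mul_one]
  rw [samplingOp₂, blockDiagonal'_diagonal, blockDiagonal'_selection fun t j => ω ⟨t, j⟩,
    gram_samplingOp_diagonal_selection (q := fun s : SpaceTime T n => p s.1 s.2)
      (fun s => hp s.1 s.2)
      fun r => (by positivity : (0 : ℝ) ≤ 1 / m r.1).trans_eq (hdiag r).symm]
  simp only [hdiag]

theorem gram_samplingOp₃ {m : ℕ} {p : SpaceTime T n → ℝ} (hp : ∀ s, 0 ≤ p s)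
    (ω : Fin m → SpaceTime T n) (M : Matrix (SpaceTime T n) ι ℝ) :
    (samplingOp₃ p ω * M)ᵀ * (samplingOp₃ p ω * M)
      = ∑ j, (1 / (m : ℝ) / p (ω j)) • rowGram M (ω j) := by
  rw [samplingOp₃, gram_samplingOp_diagonal_selection hp fun r => by simp]
  simp only [Matrix.smul_apply, one_apply_eq, smul_eq_mul, mul_one]

end SamplingOperator

section Coherence

theorem sq_le_iSup_sq_mul {α : Type*} [Finite α] {p N : α → ℝ} (hp : ∀ a, 0 < p a)
    (hN : ∀ a, 0 ≤ N a) (a : α) : N a ^ 2 ≤ (⨆ b, 1 / √(p b) * N b) ^ 2 * p a := by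
  have hle : 1 / √(p a) * N a ≤ ⨆ b, 1 / √(p b) * N b :=
    le_ciSup (f := fun b => 1 / √(p b) * N b) (Set.finite_range _).bddAbove a
  rw [one_div_mul_eq_div, div_le_iff₀ (Real.sqrt_pos.2 (hp a))] at hle
  have hsq := pow_le_pow_left₀ (hN a) hle 2
  rwa [mul_pow, Real.sq_sqrt (hp a).le] at hsq

variable {n T k : ℕ} {G : WeightedGraph n} (E : G.EigenDecomposition) (Δt : ℝ) (hk : k ≤ n)

theorem nodeNorm_nonneg (s : SpaceTime T n) : 0 ≤ nodeNorm E Δt T hk s := norm_nonneg _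

open scoped Matrix.Norms.L2Operator in
theorem vertexNorm_nonneg (i : Fin n) : 0 ≤ vertexNorm E Δt T hk i := norm_nonneg _

theorem rowGram_Utilde_le (s : SpaceTime T n) :
    rowGram (Utilde E Δt T hk) s ≤ nodeNorm E Δt T hk s ^ 2 • 1 := by
  rw [nodeNorm, mulVec_single_one]
  exact rowGram_le_norm_sq_smul_one _ s

open scoped Matrix.Norms.L2Operator in
theorem sum_rowGram_Utilde_le (i : Fin n) :
    ∑ t, rowGram (Utilde E Δt T hk) ⟨t, i⟩ ≤ vertexNorm E Δt T hk i ^ 2 • 1 :=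
  (sum_rowGram ((Utilde E Δt T hk).submatrix (fun t => ⟨t, i⟩) id)).trans_le
    (transpose_mul_self_le_norm_sq_smul_one _)

theorem sum_rowGram_Utilde_le_coherence₁ {p : Fin n → ℝ} (hp : ∀ i, 0 < p i) (i : Fin n) :
    ∑ t, rowGram (Utilde E Δt T hk) ⟨t, i⟩ ≤ (coherence₁ E Δt T hk p ^ 2 * p i) • 1 :=
  (sum_rowGram_Utilde_le E Δt hk i).trans <|
    smul_le_smul_of_nonneg_right (sq_le_iSup_sq_mul hp (vertexNorm_nonneg E Δt hk) i) zero_le_one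

theorem rowGram_Utilde_le_coherence₂ {p : Fin T → Fin n → ℝ} {t : Fin T} (hp : ∀ i, 0 < p t i)
    (i : Fin n) :
    rowGram (Utilde E Δt T hk) ⟨t, i⟩ ≤ (coherence₂ E Δt T hk p t ^ 2 * p t i) • 1 :=
  (rowGram_Utilde_le E Δt hk _).trans <|
    smul_le_smul_of_nonneg_right
      (sq_le_iSup_sq_mul hp (fun _ => nodeNorm_nonneg E Δt hk _) i) zero_le_one

theorem rowGram_Utilde_le_coherence₃ {p : SpaceTime T n → ℝ} (hp : ∀ s, 0 < p s)
    (s : SpaceTime T n) :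
    rowGram (Utilde E Δt T hk) s ≤ (coherence₃ E Δt T hk p ^ 2 * p s) • 1 :=
  (rowGram_Utilde_le E Δt hk s).trans <|
    smul_le_smul_of_nonneg_right (sq_le_iSup_sq_mul hp (nodeNorm_nonneg E Δt hk) s) zero_le_one

end Coherence

section StratifiedSampling

variable {𝕜 ι α β J : Type*} [RCLike 𝕜] [Fintype α] [Fintype β] [DecidableEq β] [Fintype J]
  {s : J → β} {m : β → ℕ} {p : β → α → ℝ} {Y : β → α → Matrix ι ι 𝕜}

theorem sum_sum_importance_smul (hm : ∀ b, Fintype.card {j // s j = b} = m b)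
    (hp : ∀ b a, p b a ≠ 0) (hY : ∀ b, m b = 0 → ∀ a, Y b a = 0) :
    ∑ j, ∑ a, p (s j) a • (1 / (m (s j) : ℝ) / p (s j) a) • Y (s j) a = ∑ b, ∑ a, Y b a := by
  have hstratum (b : β) : m b • (1 / (m b : ℝ)) • ∑ a, Y b a = ∑ a, Y b a := by
    obtain h0 | h0 := eq_or_ne (m b) 0
    · rw [h0, zero_smul, Finset.sum_eq_zero fun a _ => hY b h0 a]
    · rw [← Nat.cast_smul_eq_nsmul ℝ, smul_smul, mul_one_div_cancel (Nat.cast_ne_zero.2 h0),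
        one_smul]
  simp only [smul_smul, mul_div_cancel₀ _ (hp _ _), ← Finset.smul_sum]
  rw [← Fintype.sum_fiberwise s]
  refine Finset.sum_congr rfl fun b _ => ?_
  calc ∑ j : {j // s j = b}, (1 / (m (s j) : ℝ)) • ∑ a, Y (s j) a
    _ = ∑ _j : {j // s j = b}, (1 / (m b : ℝ)) • ∑ a, Y b a :=
        Finset.sum_congr rfl fun j _ => by rw [j.2]
    _ = m b • (1 / (m b : ℝ)) • ∑ a, Y b a := by rw [Finset.sum_const, Finset.card_univ, hm]
    _ = ∑ a, Y b a := hstratum b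

variable [Fintype ι] [DecidableEq ι] [MeasurableSpace α] [MeasurableSingletonClass α]
  {Ω : Type*} [MeasurableSpace Ω] {μ : Measure Ω} [IsProbabilityMeasure μ] {ω : J → Ω → α}
  {δ : ℝ} {ν : β → ℝ}

namespace IsIndependentSample

theorem one_sub_le_measureReal_stratified_mem_Icc
    (hω : IsIndependentSample μ (fun j => p (s j)) ω)
    (hm : ∀ b, Fintype.card {j // s j = b} = m b) (hp : ∀ b a, 0 < p b a)
    (hY0 : ∀ b a, 0 ≤ Y b a) (hY1 : ∑ b, ∑ a, Y b a = 1)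
    (hYν : ∀ b a, Y b a ≤ (ν b ^ 2 * p b a) • (1 : Matrix ι ι 𝕜))
    {R : ℝ} (hR : 0 < R) (hν : ∀ b, ν b ^ 2 ≤ R * m b) (hδ0 : 0 < δ) (hδ1 : δ < 1) :
    1 - 2 * Fintype.card ι * Real.exp (-(δ ^ 2 / (3 * R)))
      ≤ μ.real {z | ∑ j, (1 / (m (s j) : ℝ) / p (s j) (ω j z)) • Y (s j) (ω j z)
          ∈ Set.Icc ((1 - δ) • 1) ((1 + δ) • 1)} := by
  have hY_eq_zero (b : β) (hb : m b = 0) (a : α) : Y b a = 0 := by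
    refine ((hYν b a).trans_eq ?_).antisymm (hY0 b a)
    have hνb : ν b ^ 2 = 0 := ((hν b).trans_eq (by simp [hb])).antisymm (sq_nonneg _)
    rw [hνb, zero_mul, zero_smul]
  have hweight (j : J) (a : α) : 0 ≤ 1 / (m (s j) : ℝ) / p (s j) a :=
    div_nonneg (by positivity) (hp _ _).le
  have hbound (j : J) (a : α) :
      1 / (m (s j) : ℝ) / p (s j) a * (ν (s j) ^ 2 * p (s j) a) ≤ R := by
    rw [mul_comm (ν _ ^ 2), ← mul_assoc, div_mul_cancel₀ _ (hp _ _).ne', one_div_mul_eq_div]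
    exact div_le_of_le_mul₀ (Nat.cast_nonneg _) hR.le (hν _)
  refine hω.one_sub_le_measureReal_sum_mem_Icc
    (X := fun j a => (1 / (m (s j) : ℝ) / p (s j) a) • Y (s j) a) hR
    (fun j a => smul_nonneg (hweight j a) (hY0 _ _)) (fun j a => ?_)
    ((sum_sum_importance_smul hm (fun b a => (hp b a).ne') hY_eq_zero).trans hY1) hδ0 hδ1
  refine (smul_le_smul_of_nonneg_left (hYν (s j) a) (hweight j a)).trans ?_
  rw [smul_smul]
  exact smul_le_smul_of_nonneg_right (hbound j a) zero_le_one

theorem one_sub_le_measureReal_stratified_mem_Icc_of_log_le [Nonempty ι]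
    (hω : IsIndependentSample μ (fun j => p (s j)) ω)
    (hm : ∀ b, Fintype.card {j // s j = b} = m b) (hp : ∀ b a, 0 < p b a)
    (hY0 : ∀ b a, 0 ≤ Y b a) (hY1 : ∑ b, ∑ a, Y b a = 1)
    (hYν : ∀ b a, Y b a ≤ (ν b ^ 2 * p b a) • (1 : Matrix ι ι 𝕜))
    {ε : ℝ} (hε0 : 0 < ε) (hε1 : ε < 1) (hδ0 : 0 < δ) (hδ1 : δ < 1)
    (hν : ∀ b, 3 / δ ^ 2 * ν b ^ 2 * Real.log (2 * Fintype.card ι / ε) ≤ m b) :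
    1 - ε ≤ μ.real {z | ∑ j, (1 / (m (s j) : ℝ) / p (s j) (ω j z)) • Y (s j) (ω j z)
          ∈ Set.Icc ((1 - δ) • 1) ((1 + δ) • 1)} := by
  have hcard : (1 : ℝ) ≤ Fintype.card ι := mod_cast Fintype.card_pos
  have hratio : 1 < 2 * Fintype.card ι / ε := by rw [one_lt_div hε0]; linarith
  set L := Real.log (2 * Fintype.card ι / ε) with hL
  have hL0 : 0 < L := Real.log_pos hratio
  refine le_of_eq_of_le ?_ (hω.one_sub_le_measureReal_stratified_mem_Icc hm hp hY0 hY1 hYν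
    (R := δ ^ 2 / (3 * L)) (by positivity) (fun b => ?_) hδ0 hδ1)
  · have hexponent : δ ^ 2 / (3 * (δ ^ 2 / (3 * L))) = L := by field_simp
    rw [hexponent, Real.exp_neg, hL, Real.exp_log (one_pos.trans hratio), inv_div,
      mul_div_cancel₀ _ (by positivity)]
  · calc ν b ^ 2 = δ ^ 2 / (3 * L) * (3 / δ ^ 2 * ν b ^ 2 * L) := by field_simp
      _ ≤ δ ^ 2 / (3 * L) * m b := by gcongr; exact hν b

end IsIndependentSample

end StratifiedSampling

section StableEmbedding

theorem measurableSingletonClass_spaceTime {T n : ℕ} : MeasurableSingletonClass (SpaceTime T n) :=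
  ⟨fun s => MeasurableSpace.measurableSet_iInf.2 fun t => by
    change MeasurableSet (Sigma.mk t ⁻¹' {s})
    exact MeasurableSet.of_discrete⟩

variable {n T k : ℕ} {G : WeightedGraph n} (E : G.EigenDecomposition) (hk0 : 0 < k) (hk : k ≤ n)
  {Δt δ ε : ℝ} {Ω : Type*} [MeasurableSpace Ω] {μ : Measure Ω} [IsProbabilityMeasure μ]

theorem sum_sum_rowGram_Utilde (hT : 0 < T) :
    ∑ i, ∑ t : Fin T, rowGram (Utilde E Δt T hk) ⟨t, i⟩ = 1 := by
  rw [Finset.sum_comm, ← Fintype.sum_sigma, sum_rowGram, Utilde_transpose_mul_self E Δt hk hT]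

theorem one_sub_le_measureReal_stablyEmbeds {J α β ρ : Type*} [Fintype J] [Fintype α]
    [MeasurableSpace α] [MeasurableSingletonClass α] [Fintype β] [DecidableEq β] [Fintype ρ]
    {s : J → β} {m : β → ℕ} {p : β → α → ℝ} {ν : β → ℝ} {Y : β → α → Matrix (Fin k) (Fin k) ℝ}
    {ω : J → Ω → α} {B : (J → α) → Matrix ρ (SpaceTime T n) ℝ}
    (hT : 0 < T) (hω : IsIndependentSample μ (fun j => p (s j)) ω)
    (hm : ∀ b, Fintype.card {j // s j = b} = m b) (hp : ∀ b a, 0 < p b a)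
    (hY0 : ∀ b a, 0 ≤ Y b a) (hY1 : ∑ b, ∑ a, Y b a = 1)
    (hYν : ∀ b a, Y b a ≤ (ν b ^ 2 * p b a) • 1)
    (hB : ∀ x, (B x * Utilde E Δt T hk)ᵀ * (B x * Utilde E Δt T hk)
      = ∑ j, (1 / (m (s j) : ℝ) / p (s j) (x j)) • Y (s j) (x j))
    (hΔt : 0 ≤ Δt) (hδ0 : 0 < δ) (hδ1 : δ < 1) (hε0 : 0 < ε) (hε1 : ε < 1)
    (hν : ∀ b, 3 / δ ^ 2 * ν b ^ 2 * Real.log (2 * k / ε) ≤ m b) :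
    1 - ε ≤ μ.real {z | StablyEmbeds E Δt hk0 hk δ (B fun j => ω j z)} := by
  have : Nonempty (Fin k) := ⟨⟨0, hk0⟩⟩
  refine (hω.one_sub_le_measureReal_stratified_mem_Icc_of_log_le hm hp hY0 hY1 hYν hε0 hε1 hδ0 hδ1
    (by simpa only [Fintype.card_fin] using hν)).trans (measureReal_mono (μ := μ) fun z hz => ?_)
  refine stablyEmbeds_of_gram_mem_Icc E hk hT hk0 hΔt (by linarith) (by linarith) ?_
  rw [hB]
  exact hz

theorem one_sub_le_measureReal_stablyEmbeds_samplingOp₁ {p : Fin n → ℝ} {m : ℕ}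
    {ω : Fin m → Ω → Fin n} (hT : 0 < T) (hp : ∀ i, 0 < p i)
    (hω : IsIndependentSample μ (fun _ => p) ω)
    (hΔt : 0 ≤ Δt) (hδ0 : 0 < δ) (hδ1 : δ < 1) (hε0 : 0 < ε) (hε1 : ε < 1)
    (hm : 3 / δ ^ 2 * coherence₁ E Δt T hk p ^ 2 * Real.log (2 * k / ε) ≤ m) :
    1 - ε ≤ μ.real {z | StablyEmbeds E Δt hk0 hk δ (samplingOp₁ (T := T) p fun j => ω j z)} :=
  one_sub_le_measureReal_stablyEmbeds E hk0 hk (s := fun _ => ()) (p := fun _ => p)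
    (m := fun _ => m) (ν := fun _ => coherence₁ E Δt T hk p)
    (Y := fun _ i => ∑ t, rowGram (Utilde E Δt T hk) ⟨t, i⟩) (B := samplingOp₁ p) hT hω (by simp)
    (fun _ => hp) (fun _ _ => Finset.sum_nonneg fun _ _ => rowGram_nonneg _ _)
    ((Fintype.sum_unique _).trans (sum_sum_rowGram_Utilde E hk hT))
    (fun _ => sum_rowGram_Utilde_le_coherence₁ E Δt hk hp)
    (fun x => gram_samplingOp₁ (fun i => (hp i).le) x _) hΔt hδ0 hδ1 hε0 hε1 fun _ => hm

theorem one_sub_le_measureReal_stablyEmbeds_samplingOp₂ {p : Fin T → Fin n → ℝ} {m : Fin T → ℕ}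
    {ω : (Σ t : Fin T, Fin (m t)) → Ω → Fin n} (hT : 0 < T)
    (hp : ∀ t i, 0 < p t i) (hω : IsIndependentSample μ (fun r => p r.1) ω)
    (hΔt : 0 ≤ Δt) (hδ0 : 0 < δ) (hδ1 : δ < 1) (hε0 : 0 < ε) (hε1 : ε < 1)
    (hm : ∀ t, 3 / δ ^ 2 * coherence₂ E Δt T hk p t ^ 2 * Real.log (2 * k / ε) ≤ m t) :
    1 - ε ≤ μ.real {z | StablyEmbeds E Δt hk0 hk δ (samplingOp₂ p fun r => ω r z)} :=
  one_sub_le_measureReal_stablyEmbeds E hk0 hk (s := Sigma.fst) (p := p) (m := m)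
    (ν := coherence₂ E Δt T hk p)
    (Y := fun t i => rowGram (Utilde E Δt T hk) ⟨t, i⟩) (B := samplingOp₂ p) hT hω
    (fun t => (Fintype.card_congr (Equiv.sigmaSubtype t)).trans (Fintype.card_fin _))
    hp (fun _ _ => rowGram_nonneg _ _)
    (Finset.sum_comm.trans (sum_sum_rowGram_Utilde E hk hT))
    (fun t => rowGram_Utilde_le_coherence₂ E Δt hk (hp t))
    (fun x => gram_samplingOp₂ (fun t i => (hp t i).le) x _) hΔt hδ0 hδ1 hε0 hε1 hm

theorem one_sub_le_measureReal_stablyEmbeds_samplingOp₃ {p : SpaceTime T n → ℝ} {m : ℕ}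
    {ω : Fin m → Ω → SpaceTime T n} (hT : 0 < T) (hp : ∀ s, 0 < p s)
    (hω : IsIndependentSample μ (fun _ => p) ω)
    (hΔt : 0 ≤ Δt) (hδ0 : 0 < δ) (hδ1 : δ < 1) (hε0 : 0 < ε) (hε1 : ε < 1)
    (hm : 3 / δ ^ 2 * coherence₃ E Δt T hk p ^ 2 * Real.log (2 * k / ε) ≤ m) :
    1 - ε ≤ μ.real {z | StablyEmbeds E Δt hk0 hk δ (samplingOp₃ p fun j => ω j z)} :=
  have := measurableSingletonClass_spaceTime (T := T) (n := n)
  one_sub_le_measureReal_stablyEmbeds E hk0 hk (s := fun _ => ()) (p := fun _ => p)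
    (m := fun _ => m) (ν := fun _ => coherence₃ E Δt T hk p)
    (Y := fun _ => rowGram (Utilde E Δt T hk)) (B := samplingOp₃ p) hT hω (by simp)
    (fun _ => hp) (fun _ _ => rowGram_nonneg _ _)
    ((Fintype.sum_unique _).trans <| (sum_rowGram _).trans (Utilde_transpose_mul_self E Δt hk hT))
    (fun _ => rowGram_Utilde_le_coherence₃ E Δt hk hp)
    (fun x => gram_samplingOp₃ (fun s => (hp s).le) x _) hΔt hδ0 hδ1 hε0 hε1 fun _ => hm

end StableEmbedding

end DynSampling
end

theorem mainTheorem1 {n T k : ℕ} (hT : 0 < T) (hk0 : 0 < k) (hk : k ≤ n)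
    (G : DynSampling.WeightedGraph n) (E : G.EigenDecomposition) (Δt : ℝ) (hΔt : 0 < Δt)
    (δ ε : ℝ) (hδ0 : 0 < δ) (hδ1 : δ < 1) (hε0 : 0 < ε) (hε1 : ε < 1)
    {Ω : Type*} [MeasurableSpace Ω] (μ : MeasureTheory.Measure Ω)
    [MeasureTheory.IsProbabilityMeasure μ] :
    -- regime 1
    (∀ (p : Fin n → ℝ) (m : ℕ) (ω : Fin m → Ω → Fin n),
      DynSampling.IsNondegenerateDistribution p →
      DynSampling.IsIndependentSample μ (fun _ => p) ω →
      3 / δ ^ 2 * DynSampling.coherence₁ E Δt T hk p ^ 2 * Real.log (2 * k / ε) ≤ m →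
      1 - ε ≤ μ.real {z | DynSampling.StablyEmbeds E Δt hk0 hk δ
        (DynSampling.samplingOp₁ (T := T) p fun j => ω j z)}) ∧
    -- regime 2
    (∀ (p : Fin T → Fin n → ℝ) (m : Fin T → ℕ) (ω : (Σ t : Fin T, Fin (m t)) → Ω → Fin n),
      (∀ t, DynSampling.IsNondegenerateDistribution (p t)) →
      DynSampling.IsIndependentSample μ (fun s => p s.1) ω →
      (∀ t, 3 / δ ^ 2 * DynSampling.coherence₂ E Δt T hk p t ^ 2 * Real.log (2 * k / ε) ≤ m t) →
      1 - ε ≤ μ.real {z | DynSampling.StablyEmbeds E Δt hk0 hk δ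
        (DynSampling.samplingOp₂ p fun s => ω s z)}) ∧
    -- regime 3
    (∀ (p : DynSampling.SpaceTime T n → ℝ) (m : ℕ) (ω : Fin m → Ω → DynSampling.SpaceTime T n),
      DynSampling.IsNondegenerateDistribution p →
      DynSampling.IsIndependentSample μ (fun _ => p) ω →
      3 / δ ^ 2 * DynSampling.coherence₃ E Δt T hk p ^ 2 * Real.log (2 * k / ε) ≤ m →
      1 - ε ≤ μ.real {z | DynSampling.StablyEmbeds E Δt hk0 hk δ
        (DynSampling.samplingOp₃ p fun j => ω j z)}) :=
  ⟨fun _ _ _ hp hω hm => DynSampling.one_sub_le_measureReal_stablyEmbeds_samplingOp₁ E hk0 hk hT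
      hp.1 hω hΔt.le hδ0 hδ1 hε0 hε1 hm,
    fun _ _ _ hp hω hm => DynSampling.one_sub_le_measureReal_stablyEmbeds_samplingOp₂ E hk0 hk hT
      (fun t => (hp t).1) hω hΔt.le hδ0 hδ1 hε0 hε1 hm,
    fun _ _ _ hp hω hm => DynSampling.one_sub_le_measureReal_stablyEmbeds_samplingOp₃ E hk0 hk hT
      hp.1 hω hΔt.le hδ0 hδ1 hε0 hε1 hm⟩
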